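/- Let $n,p\ge 1$ and let $X\in\mathbb R^{n\times p}$ have independent entries $X_{ai}\sim N(M_{ai},1)$ with unknown mean matrix $M\in\mathbb R^{n\times p}$; let $p(X\mid M)$ be its density. The matrix quadratic loss of an estimate $\hat M$ is $L(M,\hat M)=(\hat M-M)^\top(\hat M-M)$, and the matrix quadratic risk of an estimator (a measurable map $\hat M=\hat M(X)$) is $R(M,\hat M)=\mathrm E_M[L(M,\hat M(X))]$, where $c^\top R(M,\hat M)c=\mathrm E_M[\|(\hat M(X)-M)c\|^2]\in[0,\infty]$ for $c\in\mathbb R^p$. The estimator $\hat M$ is minimax under the matrix quadratic loss if $$\sup_M c^\top R(M,\hat M)c=\inf_{\hat M'}\sup_M c^\top R(M,\hat M')c\qquad\text{for every }c\in\mathbb R^p,$$ the infimum being over all estimators $\hat M'$. A function $f:\mathbb R^{n\times p}\to[0,\infty]$ is matrix superharmonic if it is lower semicontinuous, is not identically $\infty$, and for all $X\in\mathbb R^{n\times p}$ and $\rho\in\mathbb R^p$ the average of $f(X+e\rho^\top)$ over $e$ in the unit sphere of $\mathbb R^n$ (with respect to surface measure) is at most $f(X)$. **Theorem.** Let $\pi:\mathbb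 R^{n\times p}\to[0,\infty]$ be a matrix superharmonic prior density (possibly improper, not identically $0$) whose marginal $m_\pi(X)=\int p(X\mid M)\,\pi(M)\,dM$ is finite for every $X$. Then $m_\pi>0$ everywhere, $\log m_\pi$ is differentiable, and the generalized Bayes estimator with respect to $\pi$ under the matrix quadratic loss (the estimator that for each $X$ minimizes, over $A \in \mathbb R^{n\times p}$, the posterior expected loss $\mathrm E_\pi[L(M,A)\mid X]$ in the Löwner order) exists, is unique and equals $$\hat M^\pi(X)=X+\widetilde\nabla\log m_\pi(X),\qquad (\widetilde\nabla f(X))_{ai}=\frac{\partial f}{\partial X_{ai}}(X).$$ Moreover, $\hat M^\pi$ is minimax under the matrix quadratic loss. -/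

import Mathlib

open MeasureTheory ProbabilityTheory Matrix
open scoped ENNReal

namespace MatrixBayes

noncomputable section

/-- Real `n × p` matrices, as arrays, so that the product topology, the Borel sigma-algebra and the
Lebesgue measure of `ℝ^{n × p}` are available. -/
abbrev Mat (n p : ℕ) : Type := Fin n → Fin p → ℝ

/-- The density `p(X ∣ M)` of the matrix-variate normal distribution `N_{n,p}(M, I_n, I_p)`:
the entries `X_{ai}` are independent with law `N(M_{ai}, 1)`. -/
def normalDensity {n p : ℕ} (M X : Mat n p) : ℝ≥0∞ :=
  ∏ a, ∏ i, gaussianPDF (M a i) 1 (X a i)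

/-- The law `N_{n,p}(M, I_n, I_p)` of the observation when the mean matrix is `M`. -/
def normalLaw {n p : ℕ} (M : Mat n p) : Measure (Mat n p) :=
  volume.withDensity (normalDensity M)

/-- The matrix quadratic loss `L(M, A) = (A - M)ᵀ (A - M)`. -/
def loss {n p : ℕ} (M A : Mat n p) : Matrix (Fin p) (Fin p) ℝ :=
  (Matrix.of (A - M))ᵀ * Matrix.of (A - M)

/-- The quadratic form `cᵀ R(M, δ) c = E_M [cᵀ L(M, δ(X)) c]` of the matrix quadratic risk of `δ`,
with values in `[0, ∞]`. -/
def risk {n p : ℕ} (δ : Mat n p → Mat n p) (M : Mat n p) (c : Fin p → ℝ) : ℝ≥0∞ :=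
  ∫⁻ X, ENNReal.ofReal (c ⬝ᵥ (loss M (δ X) *ᵥ c)) ∂(normalLaw M)

/-- The estimator `δ` is minimax under the matrix quadratic loss: for every `c`,
`sup_M cᵀ R(M, δ) c` is the infimum of `sup_M cᵀ R(M, δ') c` over all estimators `δ'`. -/
def IsMinimax {n p : ℕ} (δ : Mat n p → Mat n p) : Prop :=
  Measurable δ ∧ ∀ c : Fin p → ℝ,
    (⨆ M, risk δ M c) =
      ⨅ δ' : {δ' : Mat n p → Mat n p // Measurable δ'}, ⨆ M, risk δ'.1 M c

/-- The average `L(f : X, ρ)` of a nonnegative function `f` over the matrices `X + e ρᵀ`, where `e`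
runs over the unit sphere of `ℝⁿ` with its surface measure. -/
def rankOneAverage {n p : ℕ} (f : Mat n p → ℝ≥0∞) (X : Mat n p) (ρ : Fin p → ℝ) : ℝ≥0∞ :=
  ⨍⁻ e : Metric.sphere (0 : EuclideanSpace ℝ (Fin n)) 1,
    f (fun a i => X a i + (e : EuclideanSpace ℝ (Fin n)) a * ρ i)
    ∂((volume : Measure (EuclideanSpace ℝ (Fin n))).toSphere)

/-- Matrix superharmonicity of a function `f : ℝ^{n × p} → [0, ∞]`. -/
structure IsMatrixSuperharmonic {n p : ℕ} (f : Mat n p → ℝ≥0∞) : Prop where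
  lowerSemicontinuous : LowerSemicontinuous f
  exists_ne_top : ∃ X, f X ≠ ∞
  rankOneAverage_le : ∀ (X : Mat n p) (ρ : Fin p → ℝ), rankOneAverage f X ρ ≤ f X

/-- The marginal density `m_π(X) = ∫ p(X ∣ M) π(M) dM`. -/
def marginal {n p : ℕ} (π : Mat n p → ℝ≥0∞) (X : Mat n p) : ℝ≥0∞ :=
  ∫⁻ M, normalDensity M X * π M

/-- The quadratic form `cᵀ E_π[L(M, A) ∣ X] c` of the posterior expected loss of the estimate `A`
given the observation `X`, with values in `[0, ∞]`. -/
def posteriorRisk {n p : ℕ} (π : Mat n p → ℝ≥0∞) (X A : Mat n p) (c : Fin p → ℝ) : ℝ≥0∞ :=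
  (∫⁻ M, ENNReal.ofReal (c ⬝ᵥ (loss M A *ᵥ c)) * (normalDensity M X * π M)) / marginal π X

/-- `δ` is a generalized Bayes estimator with respect to `π` under the matrix quadratic loss: for
every observation `X`, the estimate `δ X` minimizes the posterior expected loss in the Loewner
order. -/
def IsGeneralizedBayes {n p : ℕ} (π : Mat n p → ℝ≥0∞) (δ : Mat n p → Mat n p) : Prop :=
  ∀ (X A : Mat n p) (c : Fin p → ℝ), posteriorRisk π X (δ X) c ≤ posteriorRisk π X A c

/-- The matrix gradient, with entries `∂ f / ∂ X_{ai}`. -/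
def matrixGradient {n p : ℕ} (f : Mat n p → ℝ) (X : Mat n p) : Mat n p :=
  fun a i => lineDeriv ℝ f X (Pi.single a (Pi.single i 1))

/-- The estimator `X + ∇ log m_π(X)`, where `∇` is the matrix gradient. -/
def bayesEstimator {n p : ℕ} (π : Mat n p → ℝ≥0∞) (X : Mat n p) : Mat n p :=
  X + matrixGradient (fun Y => Real.log (marginal π Y).toReal) X

end

end MatrixBayes

/-! Write S = n|c|². The minimax value along c is S, and the upper bound rests on one pointwise
inequality: given X, the posterior expectation of |(X - M)c|² is at most S
(`IsMatrixSuperharmonic.posteriorVar_add_le`). To obtain it, shift the Gaussian integral of π about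
X by r e cᵀ and average over unit vectors e; superharmonicity says that the average does not exceed
the unshifted integral. Moved onto the Gaussian, the shift becomes the factor exp(-r²|c|²/2) times
the mean of exp(r⟨e, Nc⟩), and that mean is at least 1 + r²|Nc|²/(2n). Comparing terms of order r²
gives the inequality, with no derivative of π involved.

All posteriors are exponential tilts of the single measure ν = exp(-|M|²/2) π(M) dM, and the
marginal is a constant times exp(-|X|²/2) Z(X), with Z the Laplace transform of ν. Finiteness of the
marginal everywhere gives ν all exponential moments, so one may differentiate under the integral:
the gradient of log Z is the posterior mean T, hence X + ∇ log m_π = T, and the derivative of T is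
the posterior covariance. The bias-variance decomposition then identifies T as the unique
generalized Bayes estimator.

By Stein's identity the risk of T along c is the Gaussian mean of 2V + |(X - T)c|² - S, where V is
the trace of the posterior covariance along c. The pointwise inequality reads V + |(X - T)c|² ≤ S,
so the risk is at most S (`integral_gaussianWeight_mul_posteriorMean_le`). Conversely, normal priors
of precision ε have Bayes risk S/(1 + ε), so letting ε → 0 shows that no estimator has worst-case
risk below S (`le_iSup_risk`). -/

namespace MatrixBayes

noncomputable section

/-! ### Laplace transforms -/

section Laplace

set_option linter.unusedSectionVars false

variable {E : Type*} [NormedAddCommGroup E] [NormedSpace ℝ E] [MeasurableSpace E] [BorelSpace E]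
  [SecondCountableTopology E]

/-- `F` is integrable against every exponential of a multiple of the norm. -/
def ExpIntegrable (ν : Measure E) (F : E → ℝ) : Prop :=
  ∀ K : ℝ, Integrable (fun M => Real.exp (K * ‖M‖) * F M) ν

lemma ExpIntegrable.integrable {ν : Measure E} {F : E → ℝ} (h : ExpIntegrable ν F) :
    Integrable F ν := by
  simpa using h 0

lemma ExpIntegrable.aestronglyMeasurable {ν : Measure E} {F : E → ℝ} (h : ExpIntegrable ν F) :
    AEStronglyMeasurable F ν :=
  h.integrable.1

lemma ExpIntegrable.mul_of_le {ν : Measure E} {F G : E → ℝ} (h : ExpIntegrable ν F)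
    (hG : AEStronglyMeasurable G ν) {C k : ℝ} (hb : ∀ M, |G M| ≤ C * Real.exp (k * ‖M‖)) :
    ExpIntegrable ν (fun M => F M * G M) := by
  intro K
  refine Integrable.mono' ((h (K + k)).norm.const_mul C) ?_ ?_
  · exact ((by fun_prop : Continuous fun M : E => Real.exp (K * ‖M‖)).aestronglyMeasurable).mul
      (h.aestronglyMeasurable.mul hG)
  · refine Filter.Eventually.of_forall fun M => ?_
    simp only [norm_mul, Real.norm_eq_abs, Real.abs_exp]
    calc Real.exp (K * ‖M‖) * (|F M| * |G M|)
        ≤ Real.exp (K * ‖M‖) * (|F M| * (C * Real.exp (k * ‖M‖))) := by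
          gcongr; exact hb M
      _ = C * (Real.exp ((K + k) * ‖M‖) * |F M|) := by
          rw [add_mul, Real.exp_add]; ring

lemma abs_clm_le_exp (L : E →L[ℝ] ℝ) (M : E) : |L M| ≤ ‖L‖ * Real.exp (1 * ‖M‖) := by
  have h1 := L.le_opNorm M
  have h2 := Real.add_one_le_exp ‖M‖
  rw [Real.norm_eq_abs] at h1
  rw [one_mul]
  nlinarith [norm_nonneg L, norm_nonneg M]

lemma ExpIntegrable.mul_clm {ν : Measure E} {F : E → ℝ} (h : ExpIntegrable ν F) (L : E →L[ℝ] ℝ) :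
    ExpIntegrable ν (fun M => F M * L M) :=
  h.mul_of_le L.continuous.aestronglyMeasurable (abs_clm_le_exp L)

variable (B : E →L[ℝ] E →L[ℝ] ℝ)

lemma ExpIntegrable.integrable_exp_mul {ν : Measure E} {F : E → ℝ} (h : ExpIntegrable ν F)
    (X : E) : Integrable (fun M => Real.exp (B X M) * F M) ν := by
  refine Integrable.mono' (h (‖B‖ * ‖X‖)).norm ?_ ?_
  · exact ((by fun_prop : Continuous fun M : E => Real.exp (B X M)).aestronglyMeasurable).mul
      h.aestronglyMeasurable
  · refine Filter.Eventually.of_forall fun M => ?_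
    simp only [norm_mul, Real.norm_eq_abs, Real.abs_exp]
    gcongr
    exact (le_abs_self _).trans (B.le_opNorm₂ X M)

/-- The Laplace transform of `F • ν` with respect to the pairing `B`. -/
def laplace (ν : Measure E) (F : E → ℝ) (X : E) : ℝ :=
  ∫ M, Real.exp (B X M) * F M ∂ν

lemma ExpIntegrable.hasFDerivAt_laplace {ν : Measure E} {F : E → ℝ} (h : ExpIntegrable ν F)
    (X : E) :
    HasFDerivAt (laplace B ν F) (∫ M, (Real.exp (B X M) * F M) • B.flip M ∂ν) X := by
  have hexp : ∀ Y : E, AEStronglyMeasurable (fun M => Real.exp (B Y M) * F M) ν := fun Y =>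
    (h.integrable_exp_mul B Y).1
  refine hasFDerivAt_integral_of_dominated_of_fderiv_le
    (F := fun Y M => Real.exp (B Y M) * F M)
    (F' := fun Y M => (Real.exp (B Y M) * F M) • B.flip M)
    -- On the unit ball around X one has ‖Y‖ ≤ ‖X‖ + 1; the extra 1 in the exponent absorbs the
    -- factor ‖M‖ ≤ exp ‖M‖ coming from the derivative.
    (bound := fun M => ‖B‖ * ‖Real.exp ((‖B‖ * (‖X‖ + 1) + 1) * ‖M‖) * F M‖)
    (Metric.ball_mem_nhds X one_pos) (Filter.Eventually.of_forall hexp)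
    (h.integrable_exp_mul B X) ((hexp X).smul B.flip.continuous.aestronglyMeasurable) ?_
    ((h _).norm.const_mul _) ?_
  · refine Filter.Eventually.of_forall fun M Y hY => ?_
    have hY' : ‖Y‖ ≤ ‖X‖ + 1 := by
      have := norm_le_norm_add_norm_sub' Y X
      rw [Metric.mem_ball, dist_eq_norm] at hY
      linarith
    have h1 : ‖B.flip M‖ ≤ ‖B‖ * ‖M‖ := by
      simpa using B.flip.le_opNorm M
    have h2 : ‖M‖ ≤ Real.exp ‖M‖ := by linarith [Real.add_one_le_exp ‖M‖]
    simp only [norm_smul, norm_mul, Real.norm_eq_abs, Real.abs_exp]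
    calc Real.exp (B Y M) * |F M| * ‖B.flip M‖
        ≤ Real.exp (‖B‖ * (‖X‖ + 1) * ‖M‖) * |F M| * (‖B‖ * Real.exp ‖M‖) := by
          gcongr
          · exact (le_abs_self _).trans ((B.le_opNorm₂ Y M).trans (by gcongr))
          · exact h1.trans (by gcongr)
      _ = ‖B‖ * (Real.exp ((‖B‖ * (‖X‖ + 1) + 1) * ‖M‖) * |F M|) := by
          rw [add_mul _ 1, Real.exp_add, one_mul]; ring
  · refine Filter.Eventually.of_forall fun M Y _ => ?_
    have h1 : HasFDerivAt (fun Z => B Z M) (B.flip M) Y := (B.flip M).hasFDerivAt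
    refine (h1.exp.mul_const (F M)).congr_fderiv ?_
    ext v
    simp
    ring

lemma ExpIntegrable.differentiable_laplace {ν : Measure E} {F : E → ℝ} (h : ExpIntegrable ν F) :
    Differentiable ℝ (laplace B ν F) :=
  fun X => (h.hasFDerivAt_laplace B X).differentiableAt

/-- A directional derivative is again a Laplace transform, so the result can be iterated: a first
derivative of the partition function gives means, a second one covariances. -/
lemma ExpIntegrable.fderiv_laplace_apply {ν : Measure E} {F : E → ℝ} (h : ExpIntegrable ν F)
    (X v : E) :
    fderiv ℝ (laplace B ν F) X v = laplace B ν (fun M => F M * B v M) X := by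
  rw [(h.hasFDerivAt_laplace B X).fderiv, ContinuousLinearMap.integral_apply]
  · simp [laplace, mul_assoc]
  · refine Integrable.mono' (((h (‖B‖ * ‖X‖ + 1)).norm).const_mul ‖B‖)
      ((h.integrable_exp_mul B X).1.smul B.flip.continuous.aestronglyMeasurable) ?_
    refine Filter.Eventually.of_forall fun M => ?_
    have h1 : ‖B.flip M‖ ≤ ‖B‖ * ‖M‖ := by
      simpa using B.flip.le_opNorm M
    have h2 : ‖M‖ ≤ Real.exp ‖M‖ := by linarith [Real.add_one_le_exp ‖M‖]
    simp only [norm_smul, norm_mul, Real.norm_eq_abs, Real.abs_exp]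
    calc Real.exp (B X M) * |F M| * ‖B.flip M‖
        ≤ Real.exp (‖B‖ * ‖X‖ * ‖M‖) * |F M| * (‖B‖ * Real.exp ‖M‖) := by
          gcongr
          · exact (le_abs_self _).trans (B.le_opNorm₂ X M)
          · exact h1.trans (by gcongr)
      _ = ‖B‖ * (Real.exp ((‖B‖ * ‖X‖ + 1) * ‖M‖) * |F M|) := by
          rw [add_mul _ 1, Real.exp_add, one_mul]; ring

end Laplace

/-! ### The Frobenius inner product and Gaussian weights -/

variable {n p : ℕ}

/-- The Frobenius inner product. -/
def frob : Mat n p →L[ℝ] Mat n p →L[ℝ] ℝ :=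
  LinearMap.toContinuousBilinearMap (LinearMap.mk₂ ℝ (fun X Y => ∑ a, X a ⬝ᵥ Y a)
    (by intros; simp [add_dotProduct, Finset.sum_add_distrib])
    (by intros; simp [smul_dotProduct, Finset.mul_sum])
    (by intros; simp [dotProduct_add, Finset.sum_add_distrib])
    (by intros; simp [dotProduct_smul, Finset.mul_sum]))

lemma frob_apply (X Y : Mat n p) : frob X Y = ∑ a, X a ⬝ᵥ Y a := rfl

lemma frob_comm (X Y : Mat n p) : frob X Y = frob Y X := by
  simp [frob_apply, dotProduct_comm]

lemma frob_single (a : Fin n) (c : Fin p → ℝ) (M : Mat n p) :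
    frob (Pi.single a c) M = M a ⬝ᵥ c := by
  rw [frob_comm, frob_apply, Finset.sum_eq_single a]
  · simp
  · intro b _ hb; simp [hb]
  · simp

lemma frob_self_nonneg (X : Mat n p) : 0 ≤ frob X X := by
  rw [frob_apply]
  exact Finset.sum_nonneg fun _ _ => Finset.sum_nonneg fun _ _ => mul_self_nonneg _

lemma sq_le_frob (X : Mat n p) (a : Fin n) (i : Fin p) : X a i ^ 2 ≤ frob X X := by
  rw [frob_apply]
  have h1 : X a ⬝ᵥ X a ≤ ∑ a, X a ⬝ᵥ X a :=
    Finset.single_le_sum (f := fun a => X a ⬝ᵥ X a)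
      (fun b _ => Finset.sum_nonneg fun i _ => mul_self_nonneg _) (Finset.mem_univ a)
  have h2 : X a i * X a i ≤ X a ⬝ᵥ X a :=
    Finset.single_le_sum (f := fun i => X a i * X a i)
      (fun i _ => mul_self_nonneg _) (Finset.mem_univ i)
  nlinarith

lemma norm_sq_le_frob (X : Mat n p) : ‖X‖ ^ 2 ≤ frob X X := by
  have h : ‖X‖ ≤ Real.sqrt (frob X X) := by
    rw [pi_norm_le_iff_of_nonneg (Real.sqrt_nonneg _)]
    intro a
    rw [pi_norm_le_iff_of_nonneg (Real.sqrt_nonneg _)]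
    intro i
    rw [Real.norm_eq_abs]
    exact Real.abs_le_sqrt (sq_le_frob X a i)
  calc ‖X‖ ^ 2 ≤ Real.sqrt (frob X X) ^ 2 := by gcongr
    _ = frob X X := Real.sq_sqrt (frob_self_nonneg X)

lemma exp_frob_eq_prod (r : ℝ) (X : Mat n p) :
    Real.exp (-(r * frob X X / 2)) = ∏ a, ∏ i, Real.exp (-(r / 2) * X a i ^ 2) := by
  simp_rw [← Real.exp_sum, frob_apply, dotProduct, ← Finset.mul_sum]
  congr 1
  simp_rw [pow_two]
  ring

lemma integrable_gaussianWeight {r : ℝ} (hr : 0 < r) :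
    Integrable (fun X : Mat n p => Real.exp (-(r * frob X X / 2))) := by
  simp_rw [exp_frob_eq_prod]
  refine Integrable.fintype_prod (f := fun (_ : Fin n) (x : Fin p → ℝ) =>
    ∏ i, Real.exp (-(r / 2) * x i ^ 2)) fun _ => ?_
  exact Integrable.fintype_prod (f := fun (_ : Fin p) (x : ℝ) => Real.exp (-(r / 2) * x ^ 2))
    fun _ => integrable_exp_neg_mul_sq (by positivity)

lemma expIntegrable_gaussianWeight {r : ℝ} (hr : 0 < r) :
    ExpIntegrable volume (fun X : Mat n p => Real.exp (-(r * frob X X / 2))) := by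
  intro K
  refine Integrable.mono' ((integrable_gaussianWeight (n := n) (p := p) (half_pos hr)).const_mul
    (Real.exp (K ^ 2 / r))) (by fun_prop) ?_
  refine Filter.Eventually.of_forall fun X => ?_
  rw [Real.norm_eq_abs, abs_of_nonneg (by positivity), ← Real.exp_add, ← Real.exp_add,
    Real.exp_le_exp]
  have h1 := norm_sq_le_frob X
  -- Completing the square spends half of the Gaussian exponent on the linear term; the other half
  -- remains integrable.
  have h2 : K * ‖X‖ ≤ K ^ 2 / r + r * ‖X‖ ^ 2 / 4 := by
    have : 0 ≤ (K - r * ‖X‖ / 2) ^ 2 / r := by positivity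
    have e : (K - r * ‖X‖ / 2) ^ 2 / r = K ^ 2 / r + r * ‖X‖ ^ 2 / 4 - K * ‖X‖ := by
      field_simp; ring
    linarith
  nlinarith

/-! ### Gaussian integration by parts. -/

lemma hasFDerivAt_gaussianWeight (r : ℝ) (X : Mat n p) :
    HasFDerivAt (fun X : Mat n p => Real.exp (-(r * frob X X / 2)))
      ((Real.exp (-(r * frob X X / 2)) * (-r)) • frob X) X := by
  have h0 : HasFDerivAt (fun X : Mat n p => frob X X) ((2 : ℝ) • frob X) X := by
    have := (frob (n := n) (p := p)).hasFDerivAt_of_bilinear (hasFDerivAt_id X) (hasFDerivAt_id X)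
    refine this.congr_fderiv ?_
    ext v
    simp [frob_comm v X]
    ring
  have h1 : HasFDerivAt (fun X : Mat n p => -(r * frob X X / 2)) ((-(r / 2)) • (2 : ℝ) • frob X) X :=
    (h0.const_mul (-(r / 2))).congr_of_eventuallyEq (Filter.Eventually.of_forall fun Y => by
      simp only; ring)
  refine h1.exp.congr_fderiv ?_
  ext v
  simp
  ring

/-- Stein's identity for the weight `exp (- r |X|² / 2)`. -/
lemma integral_gaussianWeight_mul_frob {r : ℝ} (hr : 0 < r) {g : Mat n p → ℝ}
    (hg : Differentiable ℝ g) (v : Mat n p) {C k : ℝ}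
    (hb : ∀ X, |g X| ≤ C * Real.exp (k * ‖X‖))
    (hg' : AEStronglyMeasurable (fun X => fderiv ℝ g X v)) {C' k' : ℝ}
    (hb' : ∀ X, |fderiv ℝ g X v| ≤ C' * Real.exp (k' * ‖X‖)) :
    r * ∫ X, Real.exp (-(r * frob X X / 2)) * (frob v X * g X)
      = ∫ X, Real.exp (-(r * frob X X / 2)) * fderiv ℝ g X v := by
  have hw := expIntegrable_gaussianWeight (n := n) (p := p) hr
  have hgm := hg.continuous.aestronglyMeasurable (μ := (volume : Measure (Mat n p)))
  have e1 : ∀ X : Mat n p, fderiv ℝ (fun X : Mat n p => Real.exp (-(r * frob X X / 2))) X v * g X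
      = (-r) * (Real.exp (-(r * frob X X / 2)) * frob v X * g X) := by
    intro X
    rw [(hasFDerivAt_gaussianWeight r X).fderiv]
    simp [frob_comm X v]
    ring
  have := integral_mul_fderiv_eq_neg_fderiv_mul_of_integrable (μ := (volume : Measure (Mat n p)))
    (f := fun X : Mat n p => Real.exp (-(r * frob X X / 2))) (g := g) (v := v) ?_ ?_ ?_
    (fun X _ => (hasFDerivAt_gaussianWeight r X).differentiableAt) fun X _ => hg X
  · rw [this]
    simp_rw [e1]
    rw [integral_const_mul]
    simp_rw [mul_assoc]
    ring
  · simp_rw [e1]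
    exact ((hw.mul_clm (frob v)).mul_of_le hgm hb).integrable.const_mul _
  · exact (hw.mul_of_le hg' hb').integrable
  · exact (hw.mul_of_le hgm hb).integrable

/-! ### The uniform distribution on the unit sphere -/

section Sphere

variable {E : Type*} [NormedAddCommGroup E] [InnerProductSpace ℝ E] [MeasurableSpace E]
  [BorelSpace E] [FiniteDimensional ℝ E]

/-- The action of a linear isometry on the unit sphere. -/
def sphereMap (U : E ≃ₗᵢ[ℝ] E) (e : Metric.sphere (0 : E) 1) : Metric.sphere (0 : E) 1 :=
  ⟨U e, by simp⟩

open scoped Pointwise in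
-- Surface measure of s is a multiple of the volume of the cone over s, and a linear isometry
-- carries cones to cones while preserving volume.
lemma measurePreserving_sphereMap (U : E ≃ₗᵢ[ℝ] E) :
    MeasurePreserving (sphereMap U) (volume : Measure E).toSphere
      (volume : Measure E).toSphere := by
  have hm : Measurable (sphereMap U) :=
    (U.continuous.measurable.comp measurable_subtype_coe).subtype_mk
  refine ⟨hm, ?_⟩
  ext s hs
  rw [Measure.map_apply hm hs, Measure.toSphere_apply' _ (hm hs), Measure.toSphere_apply' _ hs]
  congr 1
  conv_rhs => rw [← U.measurePreserving.measure_preimage_emb U.toHomeomorph.measurableEmbedding]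
  congr 1
  ext x
  simp only [Set.mem_smul, Set.mem_image, Set.mem_preimage, Subtype.exists, exists_and_right,
    exists_eq_right]
  constructor
  · rintro ⟨t, ht, y, ⟨hy, hys⟩, rfl⟩
    exact ⟨t, ht, U y, ⟨by simpa using hy, hys⟩, by simp⟩
  · rintro ⟨t, ht, y, ⟨hy, hys⟩, h⟩
    refine ⟨t, ht, U.symm y, ⟨by simpa using hy, ?_⟩, ?_⟩
    · have : sphereMap U ⟨U.symm y, by simpa using hy⟩ = ⟨y, hy⟩ := by
        simp [sphereMap]
      rw [this]; exact hys
    · apply U.injective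
      simpa using h

lemma lintegral_toSphere_comp (U : E ≃ₗᵢ[ℝ] E) {f : E → ℝ≥0∞} (hf : Measurable f) :
    ∫⁻ e : Metric.sphere (0 : E) 1, f (U e) ∂(volume : Measure E).toSphere
      = ∫⁻ e : Metric.sphere (0 : E) 1, f e ∂(volume : Measure E).toSphere :=
  (measurePreserving_sphereMap U).lintegral_comp (hf.comp measurable_subtype_coe)

/-- Vectors of equal norm are exchanged by the reflection in the hyperplane orthogonal to their
difference. -/
lemma lintegral_toSphere_inner_sq_congr {u v : E} (h : ‖u‖ = ‖v‖) :
    ∫⁻ e : Metric.sphere (0 : E) 1, ENNReal.ofReal (inner ℝ (e : E) u ^ 2)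
        ∂(volume : Measure E).toSphere
      = ∫⁻ e : Metric.sphere (0 : E) 1, ENNReal.ofReal (inner ℝ (e : E) v ^ 2)
        ∂(volume : Measure E).toSphere := by
  have hU := Submodule.reflection_sub h
  set U := (ℝ ∙ (u - v))ᗮ.reflection
  rw [← lintegral_toSphere_comp U (f := fun e => ENNReal.ofReal (inner ℝ e v ^ 2)) (by fun_prop)]
  refine lintegral_congr fun e => ?_
  rw [← hU, LinearIsometryEquiv.inner_map_map]

end Sphere

/-- The uniform distribution on the unit sphere of `ℝⁿ`. -/
def unifSphere (n : ℕ) : Measure (Metric.sphere (0 : EuclideanSpace ℝ (Fin n)) 1) :=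
  ((volume : Measure (EuclideanSpace ℝ (Fin n))).toSphere Set.univ)⁻¹ •
    (volume : Measure (EuclideanSpace ℝ (Fin n))).toSphere

lemma isProbabilityMeasure_unifSphere (hn : 0 < n) : IsProbabilityMeasure (unifSphere n) := by
  have : Nonempty (Fin n) := ⟨⟨0, hn⟩⟩
  constructor
  rw [unifSphere, Measure.smul_apply, smul_eq_mul]
  refine ENNReal.inv_mul_cancel ?_ (measure_ne_top _ _)
  rw [Measure.measure_univ_ne_zero]
  exact Measure.toSphere_ne_zero _

instance : IsFiniteMeasure (unifSphere n) := by
  -- In dimension zero the normalising factor is ∞, but it multiplies the zero measure, so the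
  -- result is still finite.
  rcases Nat.eq_zero_or_pos n with rfl | hn
  · have : (volume : Measure (EuclideanSpace ℝ (Fin 0))).toSphere = 0 :=
      (Measure.toSphere_eq_zero_iff _).2 inferInstance
    rw [unifSphere, this]
    simp only [smul_zero]
    infer_instance
  · have := isProbabilityMeasure_unifSphere hn
    infer_instance

lemma lintegral_unifSphere_neg {f : EuclideanSpace ℝ (Fin n) → ℝ≥0∞} (hf : Measurable f) :
    ∫⁻ e, f (-(e : EuclideanSpace ℝ (Fin n))) ∂unifSphere n
      = ∫⁻ e, f (e : EuclideanSpace ℝ (Fin n)) ∂unifSphere n := by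
  simp only [unifSphere, lintegral_smul_measure]
  congr 1
  exact lintegral_toSphere_comp (LinearIsometryEquiv.neg ℝ) hf

/-- By rotation invariance v may be replaced by ‖v‖ times any basis vector; summing over the n basis
vectors and using |e| = 1 gives ‖v‖². -/
lemma lintegral_unifSphere_inner_sq (hn : 0 < n) (v : EuclideanSpace ℝ (Fin n)) :
    ∫⁻ e, ENNReal.ofReal (inner ℝ (e : EuclideanSpace ℝ (Fin n)) v ^ 2) ∂unifSphere n
      = ENNReal.ofReal (‖v‖ ^ 2 / n) := by
  have := isProbabilityMeasure_unifSphere hn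
  set κ := ∫⁻ e, ENNReal.ofReal (inner ℝ (e : EuclideanSpace ℝ (Fin n)) v ^ 2) ∂unifSphere n
    with hκ
  have h1 : ∀ a : Fin n, κ = ∫⁻ e, ENNReal.ofReal (inner ℝ (e : EuclideanSpace ℝ (Fin n))
      (EuclideanSpace.single a ‖v‖) ^ 2) ∂unifSphere n := by
    intro a
    simp only [hκ, unifSphere, lintegral_smul_measure]
    congr 1
    exact lintegral_toSphere_inner_sq_congr (by simp)
  have h2 : (n : ℝ≥0∞) * κ = ENNReal.ofReal (‖v‖ ^ 2) := by
    calc (n : ℝ≥0∞) * κ = ∑ _a : Fin n, κ := by simp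
      _ = ∑ a : Fin n, ∫⁻ e, ENNReal.ofReal (inner ℝ (e : EuclideanSpace ℝ (Fin n))
          (EuclideanSpace.single a ‖v‖) ^ 2) ∂unifSphere n := Finset.sum_congr rfl fun a _ => h1 a
      _ = ∫⁻ e, ∑ a : Fin n, ENNReal.ofReal (inner ℝ (e : EuclideanSpace ℝ (Fin n))
          (EuclideanSpace.single a ‖v‖) ^ 2) ∂unifSphere n := by
        rw [lintegral_finsetSum]
        intro a _
        fun_prop
      _ = ∫⁻ _e, ENNReal.ofReal (‖v‖ ^ 2) ∂unifSphere n := by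
        refine lintegral_congr fun e => ?_
        rw [← ENNReal.ofReal_sum_of_nonneg (fun _ _ => sq_nonneg _)]
        congr 1
        have he : ∑ a, (e : EuclideanSpace ℝ (Fin n)) a ^ 2 = 1 := by
          have := EuclideanSpace.norm_sq_eq (e : EuclideanSpace ℝ (Fin n))
          simpa using this.symm
        simp [EuclideanSpace.inner_single_right, mul_pow, ← Finset.mul_sum, he]
      _ = ENNReal.ofReal (‖v‖ ^ 2) := by simp
  have hn' : (0 : ℝ) < n := by exact_mod_cast hn
  rw [ENNReal.ofReal_div_of_pos hn', ENNReal.ofReal_natCast, ← h2, mul_comm,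
    ENNReal.mul_div_cancel_right (by exact_mod_cast hn.ne') (by simp)]

/-- The right side is 2 + 4 sinh²(x/2), and |sinh y| ≥ |y|. -/
lemma two_add_sq_le_exp_add_exp_neg (x : ℝ) : 2 + x ^ 2 ≤ Real.exp x + Real.exp (-x) := by
  have h1 : |x / 2| ≤ |Real.sinh (x / 2)| := by
    rw [Real.abs_sinh]
    exact Real.self_le_sinh_iff.2 (abs_nonneg _)
  have h2 := sq_le_sq.2 h1
  have h3 := Real.cosh_sq (x / 2)
  have h4 := Real.cosh_two_mul (x / 2)
  have h5 := Real.cosh_eq x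
  rw [mul_div_cancel₀ x two_ne_zero] at h4
  nlinarith

/-- Pairing e with -e removes the odd part of the exponential; what is left is bounded below by its
second-order expansion, whose mean is known. -/
lemma le_lintegral_unifSphere_exp (hn : 0 < n) (v : EuclideanSpace ℝ (Fin n)) :
    ENNReal.ofReal (1 + ‖v‖ ^ 2 / (2 * n))
      ≤ ∫⁻ e, ENNReal.ofReal (Real.exp (inner ℝ (e : EuclideanSpace ℝ (Fin n)) v))
        ∂unifSphere n := by
  have := isProbabilityMeasure_unifSphere hn
  have h : ENNReal.ofReal (2 + ‖v‖ ^ 2 / n)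
      ≤ 2 * ∫⁻ e, ENNReal.ofReal (Real.exp (inner ℝ (e : EuclideanSpace ℝ (Fin n)) v))
        ∂unifSphere n := by
    rw [two_mul]
    nth_rw 2 [← lintegral_unifSphere_neg
      (f := fun e => ENNReal.ofReal (Real.exp (inner ℝ e v))) (by fun_prop)]
    rw [← lintegral_add_left (by fun_prop)]
    calc ENNReal.ofReal (2 + ‖v‖ ^ 2 / n)
        = ∫⁻ e, (ENNReal.ofReal 2 + ENNReal.ofReal (inner ℝ (e : EuclideanSpace ℝ (Fin n)) v ^ 2))
            ∂unifSphere n := by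
          rw [lintegral_add_left measurable_const, lintegral_unifSphere_inner_sq hn,
            ENNReal.ofReal_add (by norm_num) (by positivity)]
          simp
      _ ≤ _ := by
          refine lintegral_mono fun e => ?_
          simp only
          rw [← ENNReal.ofReal_add (Real.exp_pos _).le (Real.exp_pos _).le,
            ← ENNReal.ofReal_add (by norm_num) (by positivity)]
          refine ENNReal.ofReal_le_ofReal ?_
          rw [inner_neg_left]
          exact two_add_sq_le_exp_add_exp_neg _
  have e : ENNReal.ofReal (2 + ‖v‖ ^ 2 / n) = 2 * ENNReal.ofReal (1 + ‖v‖ ^ 2 / (2 * n)) := by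
    rw [two_mul, ← ENNReal.ofReal_add (by positivity) (by positivity)]
    congr 1
    field_simp
    ring
  rw [e] at h
  exact (ENNReal.mul_le_mul_iff_right (by norm_num) (by norm_num)).1 h

/-! ### The posterior second moment under a matrix superharmonic prior -/

/-- The squared Euclidean norm of `N c`. -/
def normSqMulVec (c : Fin p → ℝ) (N : Mat n p) : ℝ := ∑ a, (N a ⬝ᵥ c) ^ 2

lemma normSqMulVec_nonneg (c : Fin p → ℝ) (N : Mat n p) : 0 ≤ normSqMulVec c N :=
  Finset.sum_nonneg fun _ _ => sq_nonneg _

@[fun_prop]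
lemma continuous_normSqMulVec (c : Fin p → ℝ) :
    Continuous (normSqMulVec c : Mat n p → ℝ) := by
  unfold normSqMulVec dotProduct
  fun_prop

/-- The matrix `e cᵀ`. -/
def outer (e : EuclideanSpace ℝ (Fin n)) (c : Fin p → ℝ) : Mat n p := fun a i => e a * c i

lemma frob_outer (e : EuclideanSpace ℝ (Fin n)) (c : Fin p → ℝ) (N : Mat n p) :
    frob (outer e c) N = inner ℝ e (WithLp.toLp 2 fun a => N a ⬝ᵥ c) := by
  simp only [frob_apply, outer, PiLp.inner_apply, dotProduct]
  refine Finset.sum_congr rfl fun a _ => ?_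
  simp only [RCLike.inner_apply, conj_trivial, Finset.sum_mul]
  exact Finset.sum_congr rfl fun i _ => by ring

lemma frob_outer_self (e : Metric.sphere (0 : EuclideanSpace ℝ (Fin n)) 1) (c : Fin p → ℝ) :
    frob (outer (e : EuclideanSpace ℝ (Fin n)) c) (outer e c) = c ⬝ᵥ c := by
  have he : ∑ a, (e : EuclideanSpace ℝ (Fin n)) a ^ 2 = 1 := by
    have := EuclideanSpace.norm_sq_eq (e : EuclideanSpace ℝ (Fin n))
    simpa using this.symm
  have : ∀ a, (outer (e : EuclideanSpace ℝ (Fin n)) c a) ⬝ᵥ (outer (e : EuclideanSpace ℝ (Fin n)) c a)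
      = (e : EuclideanSpace ℝ (Fin n)) a ^ 2 * (c ⬝ᵥ c) := by
    intro a
    simp only [outer, dotProduct, Finset.mul_sum]
    exact Finset.sum_congr rfl fun i _ => by ring
  rw [frob_apply]
  simp_rw [this]
  rw [← Finset.sum_mul, he, one_mul]

lemma continuous_outer (c : Fin p → ℝ) :
    Continuous fun e : EuclideanSpace ℝ (Fin n) => outer e c := by
  unfold outer
  fun_prop

lemma rankOneAverage_eq (f : Mat n p → ℝ≥0∞) (X : Mat n p) (c : Fin p → ℝ) :
    rankOneAverage f X c
      = ∫⁻ e, f (X + outer (e : EuclideanSpace ℝ (Fin n)) c) ∂unifSphere n := rfl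

/-- Since |e cᵀ| = |c| for unit e, the direction e enters only through the linear exponent ⟨e, Nc⟩.
-/
lemma exp_sub_outer (N : Mat n p) (e : Metric.sphere (0 : EuclideanSpace ℝ (Fin n)) 1)
    (c : Fin p → ℝ) :
    Real.exp (-(frob (N - outer (e : EuclideanSpace ℝ (Fin n)) c)
        (N - outer (e : EuclideanSpace ℝ (Fin n)) c) / 2))
      = Real.exp (-(c ⬝ᵥ c / 2)) * (Real.exp (-(frob N N / 2)) *
        Real.exp (inner ℝ (e : EuclideanSpace ℝ (Fin n)) (WithLp.toLp 2 fun a => N a ⬝ᵥ c))) := by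
  rw [← Real.exp_add, ← Real.exp_add]
  congr 1
  simp only [map_sub, _root_.sub_apply]
  rw [frob_comm N (outer _ c), frob_outer_self, frob_outer]
  ring

lemma norm_sq_toLp_dotProduct (N : Mat n p) (c : Fin p → ℝ) :
    ‖(WithLp.toLp 2 fun a => N a ⬝ᵥ c : EuclideanSpace ℝ (Fin n))‖ ^ 2 = normSqMulVec c N := by
  rw [EuclideanSpace.norm_sq_eq]
  simp [normSqMulVec]

/-- Integrated form of superharmonicity: Tonelli lets the translation by e cᵀ pass between `f`,
where the spherical average decreases it, and the Gaussian, where the average is bounded below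
explicitly. -/
lemma IsMatrixSuperharmonic.lintegral_translate_le {f : Mat n p → ℝ≥0∞}
    (hf : IsMatrixSuperharmonic f) (hn : 0 < n) (X : Mat n p) (c : Fin p → ℝ) :
    ENNReal.ofReal (Real.exp (-(c ⬝ᵥ c / 2))) *
      ∫⁻ N, ENNReal.ofReal (1 + normSqMulVec c N / (2 * n)) *
        (ENNReal.ofReal (Real.exp (-(frob N N / 2))) * f (X + N))
    ≤ ∫⁻ N, ENNReal.ofReal (Real.exp (-(frob N N / 2))) * f (X + N) := by
  have hfm : Measurable f := hf.lowerSemicontinuous.measurable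
  have hout : Measurable fun e : Metric.sphere (0 : EuclideanSpace ℝ (Fin n)) 1 =>
      outer (e : EuclideanSpace ℝ (Fin n)) c :=
    ((continuous_outer c).comp continuous_subtype_val).measurable
  calc _ = ∫⁻ N, ENNReal.ofReal (Real.exp (-(c ⬝ᵥ c / 2))) *
        (ENNReal.ofReal (1 + normSqMulVec c N / (2 * n)) *
        (ENNReal.ofReal (Real.exp (-(frob N N / 2))) * f (X + N))) := by
        rw [lintegral_const_mul]
        fun_prop
    _ ≤ ∫⁻ N, ∫⁻ e, ENNReal.ofReal (Real.exp (-(frob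
          (N - outer (e : EuclideanSpace ℝ (Fin n)) c)
          (N - outer (e : EuclideanSpace ℝ (Fin n)) c) / 2))) * f (X + N) ∂unifSphere n := by
        refine lintegral_mono fun N => ?_
        simp_rw [exp_sub_outer]
        have h := le_lintegral_unifSphere_exp hn (WithLp.toLp 2 fun a => N a ⬝ᵥ c)
        rw [norm_sq_toLp_dotProduct] at h
        calc _ ≤ ENNReal.ofReal (Real.exp (-(c ⬝ᵥ c / 2))) *
              ((∫⁻ e, ENNReal.ofReal (Real.exp (inner ℝ (e : EuclideanSpace ℝ (Fin n))
                (WithLp.toLp 2 fun a => N a ⬝ᵥ c))) ∂unifSphere n) *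
              (ENNReal.ofReal (Real.exp (-(frob N N / 2))) * f (X + N))) := by gcongr
          _ = _ := by
            rw [← lintegral_mul_const _ (by fun_prop), ← lintegral_const_mul _ (by fun_prop)]
            refine lintegral_congr fun e => ?_
            rw [ENNReal.ofReal_mul (by positivity), ENNReal.ofReal_mul (by positivity)]
            ring
    _ = ∫⁻ e, ∫⁻ N, ENNReal.ofReal (Real.exp (-(frob
          (N - outer (e : EuclideanSpace ℝ (Fin n)) c)
          (N - outer (e : EuclideanSpace ℝ (Fin n)) c) / 2))) * f (X + N) ∂volume
          ∂unifSphere n := by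
        rw [lintegral_lintegral_swap]
        refine Measurable.aemeasurable ?_
        have h1 : Measurable fun q : Mat n p × Metric.sphere (0 : EuclideanSpace ℝ (Fin n)) 1 =>
            q.1 - outer (q.2 : EuclideanSpace ℝ (Fin n)) c :=
          measurable_fst.sub (hout.comp measurable_snd)
        have h2 : Measurable fun N : Mat n p =>
          ENNReal.ofReal (Real.exp (-(frob N N / 2))) := by fun_prop
        exact (h2.comp h1).mul (hfm.comp (measurable_fst.const_add X))
    _ = ∫⁻ e, ∫⁻ N, ENNReal.ofReal (Real.exp (-(frob N N / 2))) *
          f (X + N + outer (e : EuclideanSpace ℝ (Fin n)) c) ∂volume ∂unifSphere n := by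
        refine lintegral_congr fun e => ?_
        rw [← lintegral_add_right_eq_self _ (outer (e : EuclideanSpace ℝ (Fin n)) c)]
        simp [add_assoc]
    _ = ∫⁻ N, ∫⁻ e, ENNReal.ofReal (Real.exp (-(frob N N / 2))) *
          f (X + N + outer (e : EuclideanSpace ℝ (Fin n)) c) ∂unifSphere n := by
        rw [lintegral_lintegral_swap]
        refine Measurable.aemeasurable ?_
        have h1 : Measurable fun q : Metric.sphere (0 : EuclideanSpace ℝ (Fin n)) 1 × Mat n p =>
            X + q.2 + outer (q.1 : EuclideanSpace ℝ (Fin n)) c :=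
          (measurable_snd.const_add X).add (hout.comp measurable_fst)
        have h2 : Measurable fun N : Mat n p =>
          ENNReal.ofReal (Real.exp (-(frob N N / 2))) := by fun_prop
        exact (h2.comp measurable_snd).mul (hfm.comp h1)
    _ ≤ _ := by
        refine lintegral_mono fun N => ?_
        simp only
        have hm := hfm.comp (hout.const_add (X + N))
        simp only [Function.comp_def] at hm
        rw [lintegral_const_mul _ hm]
        gcongr
        rw [← rankOneAverage_eq]
        exact hf.rankOneAverage_le _ _

/-- The translation inequality is applied to r c: its terms of order zero cancel, and dividing by r²
and letting r → 0 leaves the second moment bound. -/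
lemma IsMatrixSuperharmonic.lintegral_normSqMulVec_le {f : Mat n p → ℝ≥0∞}
    (hf : IsMatrixSuperharmonic f) (hn : 0 < n) (X : Mat n p)
    (hfin : ∫⁻ N, ENNReal.ofReal (Real.exp (-(frob N N / 2))) * f (X + N) ≠ ∞)
    (c : Fin p → ℝ) :
    ∫⁻ N, ENNReal.ofReal (normSqMulVec c N) *
        (ENNReal.ofReal (Real.exp (-(frob N N / 2))) * f (X + N))
    ≤ ENNReal.ofReal (n * (c ⬝ᵥ c)) *
      ∫⁻ N, ENNReal.ofReal (Real.exp (-(frob N N / 2))) * f (X + N) := by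
  have hfm : Measurable f := hf.lowerSemicontinuous.measurable
  have hn' : (0 : ℝ) < n := by exact_mod_cast hn
  set m := ∫⁻ N, ENNReal.ofReal (Real.exp (-(frob N N / 2))) * f (X + N) with hm
  set J := ∫⁻ N, ENNReal.ofReal (normSqMulVec c N) *
        (ENNReal.ofReal (Real.exp (-(frob N N / 2))) * f (X + N)) with hJ
  set s : ℝ := c ⬝ᵥ c with hs
  have hs0 : 0 ≤ s := Finset.sum_nonneg fun i _ => mul_self_nonneg _
  have key : ∀ r : ℝ, 0 < r → J ≤ ENNReal.ofReal (n * s * Real.exp (r ^ 2 * s / 2)) * m := by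
    intro r hr
    have h := hf.lintegral_translate_le hn X (r • c)
    rw [← hm] at h
    have e1 : (r • c) ⬝ᵥ (r • c) = r ^ 2 * s := by
      rw [smul_dotProduct, dotProduct_smul, hs]; simp; ring
    have e2 : ∫⁻ N, ENNReal.ofReal (1 + normSqMulVec (r • c) N / (2 * n)) *
        (ENNReal.ofReal (Real.exp (-(frob N N / 2))) * f (X + N))
        = m + ENNReal.ofReal (r ^ 2 / (2 * n)) * J := by
      rw [hm, hJ, ← lintegral_const_mul _ (by fun_prop), ← lintegral_add_left (by fun_prop)]
      refine lintegral_congr fun N => ?_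
      have e3 : normSqMulVec (r • c) N / (2 * n) = r ^ 2 / (2 * n) * normSqMulVec c N := by
        simp only [normSqMulVec, dotProduct_smul, smul_eq_mul, mul_pow, ← Finset.mul_sum]
        ring
      rw [e3, ENNReal.ofReal_add (by norm_num)
        (mul_nonneg (by positivity) (normSqMulVec_nonneg _ _)), ENNReal.ofReal_mul (by positivity),
        ENNReal.ofReal_one]
      ring
    rw [e1, e2] at h
    -- J occurs on the smaller side with a positive coefficient, so a finite m forces it to be
    -- finite.
    have hJfin : J ≠ ∞ := by
      intro hJ'
      rw [hJ', ENNReal.mul_top (by simpa using by positivity), add_top,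
        ENNReal.mul_top (by simpa using Real.exp_pos _)] at h
      exact hfin (top_le_iff.1 h)
    rw [← ENNReal.ofReal_toReal hfin, ← ENNReal.ofReal_toReal hJfin] at h ⊢
    have hm0 : 0 ≤ m.toReal := ENNReal.toReal_nonneg
    have hJ0 : 0 ≤ J.toReal := ENNReal.toReal_nonneg
    rw [← ENNReal.ofReal_mul (by positivity), ← ENNReal.ofReal_add hm0 (by positivity),
      ← ENNReal.ofReal_mul (by positivity), ENNReal.ofReal_le_ofReal_iff hm0] at h
    rw [← ENNReal.ofReal_mul (by positivity)]
    refine ENNReal.ofReal_le_ofReal ?_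
    set x := r ^ 2 * s / 2 with hx
    have hexp : Real.exp (-x) * Real.exp x = 1 := by rw [← Real.exp_add]; simp
    have h3 : m.toReal + r ^ 2 / (2 * n) * J.toReal ≤ Real.exp x * m.toReal := by
      have := mul_le_mul_of_nonneg_left h (Real.exp_pos x).le
      calc _ = Real.exp (-x) * Real.exp x * (m.toReal + r ^ 2 / (2 * n) * J.toReal) := by
            rw [hexp, one_mul]
        _ ≤ _ := by linarith
    -- This makes the right side a multiple of x = r²s/2, so that r² cancels.
    have h4 : Real.exp x - 1 ≤ x * Real.exp x := by
      have := mul_le_mul_of_nonneg_right (Real.add_one_le_exp (-x)) (Real.exp_pos x).le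
      linarith
    have h5 : r ^ 2 / (2 * n) * J.toReal ≤ r ^ 2 / (2 * n) * (n * s * Real.exp x * m.toReal) := by
      calc _ ≤ (Real.exp x - 1) * m.toReal := by linarith
        _ ≤ x * Real.exp x * m.toReal := by gcongr
        _ = _ := by rw [hx]; field_simp
    exact le_of_mul_le_mul_left h5 (by positivity)
  have hlim : Filter.Tendsto (fun r : ℝ => ENNReal.ofReal (n * s * Real.exp (r ^ 2 * s / 2)) * m)
      (nhdsWithin 0 (Set.Ioi 0)) (nhds (ENNReal.ofReal (n * s) * m)) := by
    have hc : Continuous fun r : ℝ => ENNReal.ofReal (n * s * Real.exp (r ^ 2 * s / 2)) := by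
      exact ENNReal.continuous_ofReal.comp (by fun_prop)
    have := (hc.tendsto 0).mono_left (nhdsWithin_le_nhds (s := Set.Ioi 0))
    simp only [ne_eq, OfNat.ofNat_ne_zero, not_false_eq_true, zero_pow, zero_mul, zero_div,
      Real.exp_zero, mul_one] at this
    exact ENNReal.Tendsto.mul_const this (Or.inr hfin)
  exact ge_of_tendsto hlim (Filter.eventually_of_mem self_mem_nhdsWithin key)

/-! ### Posterior distributions as exponentially tilted measures -/

/-- The posterior distribution given `X`, where `ν` is the Gaussian weight times the prior. -/
def posterior (ν : Measure (Mat n p)) (X : Mat n p) : Measure (Mat n p) :=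
  ν.tilted fun M => frob X M

/-- The posterior mean. -/
def posteriorMean (ν : Measure (Mat n p)) (X : Mat n p) : Mat n p :=
  ∫ M, M ∂posterior ν X

/-- The partition function of the exponential family generated by `ν`. -/
def partitionFn (ν : Measure (Mat n p)) : Mat n p → ℝ :=
  laplace frob ν fun _ => 1

variable {ν : Measure (Mat n p)}

lemma partitionFn_eq (X : Mat n p) : partitionFn ν X = ∫ M, Real.exp (frob X M) ∂ν := by
  simp [partitionFn, laplace]

/-- The norm is a maximum of finitely many |M a i|, and each exp(|K||M a i|) is at most a sum of two
exponentials of single entries, which are integrable by the hypothesis at multiples of matrix units.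
-/
lemma expIntegrable_one (h : ∀ X : Mat n p, Integrable (fun M => Real.exp (frob X M)) ν) :
    ExpIntegrable ν fun _ => 1 := by
  intro K
  have hi : ∀ (a : Fin n) (i : Fin p) (t : ℝ),
      Integrable (fun M : Mat n p => Real.exp (t * M a i)) ν := by
    intro a i t
    have := h (Pi.single a (Pi.single i t))
    simp_rw [frob_single] at this
    simpa [mul_comm] using this
  have h0 : Integrable (fun _ : Mat n p => (1 : ℝ)) ν := by simpa using h 0
  have hR : Integrable (fun M : Mat n p =>
      -- The summand 1 keeps log R nonnegative, as the criterion for bounding a sup norm requires,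
      -- even when there are no entries.
      1 + ∑ a, ∑ i, (Real.exp (|K| * M a i) + Real.exp (-|K| * M a i))) ν :=
    h0.add (integrable_finsetSum _ fun a _ => integrable_finsetSum _ fun i _ =>
      (hi a i _).add (hi a i _))
  refine hR.mono' (by fun_prop) (Filter.Eventually.of_forall fun M => ?_)
  rw [mul_one, Real.norm_eq_abs, Real.abs_exp]
  set R := 1 + ∑ a, ∑ i, (Real.exp (|K| * M a i) + Real.exp (-|K| * M a i)) with hRdef
  have hR1 : 1 ≤ R := by
    rw [hRdef]
    have : 0 ≤ ∑ a, ∑ i, (Real.exp (|K| * M a i) + Real.exp (-|K| * M a i)) := by positivity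
    linarith
  have hle : ∀ a i, |K| * |M a i| ≤ Real.log R := by
    intro a i
    rw [Real.le_log_iff_exp_le (by linarith)]
    have h1 : ∑ i, (Real.exp (|K| * M a i) + Real.exp (-|K| * M a i))
        ≤ ∑ a, ∑ i, (Real.exp (|K| * M a i) + Real.exp (-|K| * M a i)) :=
      Finset.single_le_sum (f := fun a => ∑ i, (Real.exp (|K| * M a i) +
        Real.exp (-|K| * M a i))) (fun _ _ => by positivity) (Finset.mem_univ a)
    have h2 : Real.exp (|K| * M a i) + Real.exp (-|K| * M a i)
        ≤ ∑ i, (Real.exp (|K| * M a i) + Real.exp (-|K| * M a i)) :=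
      Finset.single_le_sum (f := fun i => Real.exp (|K| * M a i) + Real.exp (-|K| * M a i))
        (fun _ _ => by positivity) (Finset.mem_univ i)
    have h3 : Real.exp (|K| * |M a i|) ≤ Real.exp (|K| * M a i) + Real.exp (-|K| * M a i) := by
      rcases abs_cases (M a i) with ⟨e, _⟩ | ⟨e, _⟩ <;> rw [e]
      · linarith [Real.exp_pos (-|K| * M a i)]
      · rw [mul_neg, ← neg_mul]
        linarith [Real.exp_pos (|K| * M a i)]
    linarith
  rw [← Real.le_log_iff_exp_le (by linarith)]
  have hlog : 0 ≤ Real.log R := Real.log_nonneg hR1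
  rcases eq_or_ne K 0 with rfl | hK
  · simpa using hlog
  have hK' : 0 < |K| := abs_pos.2 hK
  have hM : ‖M‖ ≤ Real.log R / |K| := by
    rw [pi_norm_le_iff_of_nonneg (by positivity)]
    intro a
    rw [pi_norm_le_iff_of_nonneg (by positivity)]
    intro i
    rw [le_div_iff₀ hK', mul_comm]
    exact hle a i
  rw [le_div_iff₀ hK', mul_comm] at hM
  exact (mul_le_mul_of_nonneg_right (le_abs_self K) (norm_nonneg _)).trans hM


/-! ### Moments of the tilted measures. -/

lemma ExpIntegrable.frob_left (h1 : ExpIntegrable ν fun _ => 1) (v : Mat n p) :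
    ExpIntegrable ν fun M => frob v M := by
  simpa using h1.mul_clm (frob v)

lemma ExpIntegrable.frob_left_sq (h1 : ExpIntegrable ν fun _ => 1) (v : Mat n p) :
    ExpIntegrable ν fun M => frob v M * frob v M :=
  (h1.frob_left v).mul_clm (frob v)

lemma ExpIntegrable.integrable_exp_frob (h1 : ExpIntegrable ν fun _ => 1) (X : Mat n p) :
    Integrable (fun M => Real.exp (frob X M)) ν := by
  simpa using h1.integrable_exp_mul frob X

lemma ExpIntegrable.partitionFn_pos [NeZero ν] (h1 : ExpIntegrable ν fun _ => 1) (X : Mat n p) :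
    0 < partitionFn ν X := by
  rw [partitionFn_eq]
  exact integral_exp_pos (h1.integrable_exp_frob X)

lemma ExpIntegrable.isProbabilityMeasure_posterior [NeZero ν] (h1 : ExpIntegrable ν fun _ => 1)
    (X : Mat n p) : IsProbabilityMeasure (posterior ν X) :=
  isProbabilityMeasure_tilted (h1.integrable_exp_frob X)

lemma ExpIntegrable.integrable_posterior {F : Mat n p → ℝ} (h1 : ExpIntegrable ν fun _ => 1)
    (h : ExpIntegrable ν F) (X : Mat n p) : Integrable F (posterior ν X) := by
  rw [posterior, integrable_tilted_iff (h1.integrable_exp_frob X)]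
  exact h.integrable_exp_mul frob X

lemma integral_posterior (F : Mat n p → ℝ) (X : Mat n p) :
    ∫ M, F M ∂posterior ν X = laplace frob ν F X / partitionFn ν X := by
  rw [posterior, integral_tilted, ← partitionFn_eq, laplace, ← integral_div]
  congr 1 with M
  simp only [smul_eq_mul]
  ring

lemma lintegral_posterior (h1 : ExpIntegrable ν fun _ => 1) [NeZero ν] {G : Mat n p → ℝ≥0∞}
    (hG : Measurable G) (X : Mat n p) :
    ∫⁻ M, G M * ENNReal.ofReal (Real.exp (frob X M)) ∂ν
      = ENNReal.ofReal (partitionFn ν X) * ∫⁻ M, G M ∂posterior ν X := by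
  rw [posterior, lintegral_tilted, ← partitionFn_eq, ← lintegral_const_mul _ (by fun_prop)]
  refine lintegral_congr fun M => ?_
  rw [← mul_assoc, ← ENNReal.ofReal_mul (h1.partitionFn_pos X).le,
    mul_div_cancel₀ _ (h1.partitionFn_pos X).ne', mul_comm]

lemma ExpIntegrable.frob_posteriorMean [NeZero ν] (h1 : ExpIntegrable ν fun _ => 1)
    (v X : Mat n p) : frob v (posteriorMean ν X) = ∫ M, frob v M ∂posterior ν X := by
  have hid : Integrable (fun M => M) (posterior ν X) := by
    refine Integrable.of_eval fun a => Integrable.of_eval fun i => ?_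
    have := h1.integrable_posterior (h1.frob_left (Pi.single a (Pi.single i 1))) X
    simpa [frob_single] using this
  exact ((frob v).integral_comp_comm hid).symm

lemma ExpIntegrable.frob_posteriorMean_eq_div [NeZero ν] (h1 : ExpIntegrable ν fun _ => 1)
    (v X : Mat n p) :
    frob v (posteriorMean ν X) = laplace frob ν (fun M => frob v M) X / partitionFn ν X := by
  rw [h1.frob_posteriorMean, integral_posterior]

lemma ExpIntegrable.fderiv_partitionFn_apply (h1 : ExpIntegrable ν fun _ => 1) (X v : Mat n p) :
    fderiv ℝ (partitionFn ν) X v = laplace frob ν (fun M => frob v M) X := by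
  have h := h1.fderiv_laplace_apply frob X v
  simp only [one_mul] at h
  exact h

lemma ExpIntegrable.hasFDerivAt_frob_posteriorMean [NeZero ν]
    (h1 : ExpIntegrable ν fun _ => 1) (v X : Mat n p) :
    HasFDerivAt (fun X => frob v (posteriorMean ν X))
      (laplace frob ν (fun M => frob v M) X •
          (-(partitionFn ν X ^ 2)⁻¹ • fderiv ℝ (partitionFn ν) X) +
        (partitionFn ν X)⁻¹ • fderiv ℝ (laplace frob ν fun M => frob v M) X) X := by
  simp_rw [h1.frob_posteriorMean_eq_div, div_eq_mul_inv]
  have h2 := ((h1.frob_left v).differentiable_laplace frob X).hasFDerivAt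
  have h3 : HasFDerivAt (partitionFn ν) (fderiv ℝ (partitionFn ν) X) X :=
    (h1.differentiable_laplace frob X).hasFDerivAt
  exact h2.mul ((hasDerivAt_inv (h1.partitionFn_pos X).ne').comp_hasFDerivAt X h3)

lemma ExpIntegrable.differentiable_frob_posteriorMean [NeZero ν]
    (h1 : ExpIntegrable ν fun _ => 1) (v : Mat n p) :
    Differentiable ℝ fun X => frob v (posteriorMean ν X) :=
  fun X => (h1.hasFDerivAt_frob_posteriorMean v X).differentiableAt

lemma ExpIntegrable.continuous_posteriorMean [NeZero ν] (h1 : ExpIntegrable ν fun _ => 1) :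
    Continuous (posteriorMean ν) := by
  refine continuous_pi fun a => continuous_pi fun i => ?_
  have := (h1.differentiable_frob_posteriorMean (Pi.single a (Pi.single i 1))).continuous
  simpa [frob_single] using this

/-- In an exponential family the derivative of the mean is the covariance; here it follows from the
quotient rule applied to two Laplace transforms. -/
lemma ExpIntegrable.fderiv_frob_posteriorMean [NeZero ν]
    (h1 : ExpIntegrable ν fun _ => 1) (v X : Mat n p) :
    fderiv ℝ (fun X => frob v (posteriorMean ν X)) X v
      = ∫ M, frob v M * frob v M ∂posterior ν X - frob v (posteriorMean ν X) ^ 2 := by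
  have hZ := (h1.partitionFn_pos X).ne'
  have e2 := (h1.frob_left v).fderiv_laplace_apply frob X v
  rw [(h1.hasFDerivAt_frob_posteriorMean v X).fderiv, h1.frob_posteriorMean_eq_div,
    integral_posterior]
  simp [h1.fderiv_partitionFn_apply, e2]
  field_simp
  ring

/-- Bias-variance decomposition in the direction v. -/
lemma ExpIntegrable.integral_frob_sub_sq [NeZero ν] (h1 : ExpIntegrable ν fun _ => 1)
    (v X A : Mat n p) :
    ∫ M, frob v (A - M) ^ 2 ∂posterior ν X
      = (∫ M, frob v M * frob v M ∂posterior ν X - frob v (posteriorMean ν X) ^ 2)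
        + frob v (A - posteriorMean ν X) ^ 2 := by
  have := h1.isProbabilityMeasure_posterior X
  have i1 := h1.integrable_posterior (h1.frob_left v) X
  have i2 := h1.integrable_posterior (h1.frob_left_sq v) X
  have e : ∀ M, frob v (A - M) ^ 2
      = frob v M * frob v M + (frob v A ^ 2 - (2 * frob v A) * frob v M) := by
    intro M; rw [map_sub]; ring
  simp_rw [e]
  have i3 : Integrable (fun M => frob v A ^ 2 - (2 * frob v A) * frob v M) (posterior ν X) :=
    (integrable_const _).sub (i1.const_mul _)
  rw [integral_add i2 i3, integral_sub (integrable_const _) (i1.const_mul _), integral_const_mul,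
    ← h1.frob_posteriorMean]
  simp only [integral_const, probReal_univ, one_smul]
  ring

lemma ExpIntegrable.integrable_frob_sub_sq [NeZero ν] (h1 : ExpIntegrable ν fun _ => 1)
    (v X A : Mat n p) : Integrable (fun M => frob v (A - M) ^ 2) (posterior ν X) := by
  have := h1.isProbabilityMeasure_posterior X
  have i1 := h1.integrable_posterior (h1.frob_left v) X
  have i2 := h1.integrable_posterior (h1.frob_left_sq v) X
  have e : ∀ M, frob v (A - M) ^ 2
      = frob v M * frob v M + (frob v A ^ 2 - (2 * frob v A) * frob v M) := by
    intro M; rw [map_sub]; ring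
  simp_rw [e]
  exact i2.add ((integrable_const _).sub (i1.const_mul _))

lemma normSqMulVec_eq_sum_frob (c : Fin p → ℝ) (N : Mat n p) :
    normSqMulVec c N = ∑ a, frob (Pi.single a c) N ^ 2 := by
  simp [normSqMulVec, frob_single]

lemma ExpIntegrable.integrable_normSqMulVec_sub [NeZero ν] (h1 : ExpIntegrable ν fun _ => 1)
    (c : Fin p → ℝ) (X A : Mat n p) :
    Integrable (fun M => normSqMulVec c (A - M)) (posterior ν X) := by
  simp_rw [normSqMulVec_eq_sum_frob]
  exact integrable_finsetSum _ fun a _ => h1.integrable_frob_sub_sq _ _ _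

/-- The trace of the posterior covariance in direction `c`. -/
def posteriorVar (ν : Measure (Mat n p)) (c : Fin p → ℝ) (X : Mat n p) : ℝ :=
  ∑ a, (∫ M, frob (Pi.single a c) M * frob (Pi.single a c) M ∂posterior ν X
    - frob (Pi.single a c) (posteriorMean ν X) ^ 2)

lemma ExpIntegrable.integral_normSqMulVec_sub [NeZero ν] (h1 : ExpIntegrable ν fun _ => 1)
    (c : Fin p → ℝ) (X A : Mat n p) :
    ∫ M, normSqMulVec c (A - M) ∂posterior ν X
      = posteriorVar ν c X + normSqMulVec c (A - posteriorMean ν X) := by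
  simp_rw [normSqMulVec_eq_sum_frob, posteriorVar]
  rw [integral_finsetSum _ fun a _ => h1.integrable_frob_sub_sq _ _ _, ← Finset.sum_add_distrib]
  exact Finset.sum_congr rfl fun a _ => h1.integral_frob_sub_sq _ _ _

lemma ExpIntegrable.lintegral_normSqMulVec_sub [NeZero ν] (h1 : ExpIntegrable ν fun _ => 1)
    (c : Fin p → ℝ) (X A : Mat n p) :
    ∫⁻ M, ENNReal.ofReal (normSqMulVec c (A - M)) ∂posterior ν X
      = ENNReal.ofReal (posteriorVar ν c X + normSqMulVec c (A - posteriorMean ν X)) := by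
  rw [← h1.integral_normSqMulVec_sub, ofReal_integral_eq_lintegral_ofReal
    (h1.integrable_normSqMulVec_sub c X A)
    (Filter.Eventually.of_forall fun M => normSqMulVec_nonneg _ _)]

lemma ExpIntegrable.posteriorVar_nonneg [NeZero ν] (h1 : ExpIntegrable ν fun _ => 1)
    (c : Fin p → ℝ) (X : Mat n p) : 0 ≤ posteriorVar ν c X := by
  have h := h1.integral_normSqMulVec_sub c X (posteriorMean ν X)
  have h2 : 0 ≤ ∫ M, normSqMulVec c (posteriorMean ν X - M) ∂posterior ν X :=
    integral_nonneg fun M => normSqMulVec_nonneg _ _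
  have h3 : normSqMulVec c (0 : Mat n p) = 0 := by simp [normSqMulVec]
  rw [h, sub_self, h3, add_zero] at h2
  exact h2

/-! ### The normal model -/

/-- The normalizing constant of the matrix normal density. -/
def normConst (n p : ℕ) : ℝ := ∏ _a : Fin n, ∏ _i : Fin p, (Real.sqrt (2 * Real.pi))⁻¹

lemma normConst_pos : 0 < normConst n p :=
  Finset.prod_pos fun _ _ => Finset.prod_pos fun _ _ => by positivity

lemma normalDensity_eq (M X : Mat n p) :
    normalDensity M X
      = ENNReal.ofReal (normConst n p) * ENNReal.ofReal (Real.exp (-(frob (X - M) (X - M) / 2))) := by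
  have h := exp_frob_eq_prod 1 (X - M)
  rw [one_mul] at h
  rw [h, normConst, ← ENNReal.ofReal_mul (by positivity)]
  simp_rw [← Finset.prod_mul_distrib]
  rw [ENNReal.ofReal_prod_of_nonneg (fun _ _ => by positivity), normalDensity]
  refine Finset.prod_congr rfl fun a _ => ?_
  rw [ENNReal.ofReal_prod_of_nonneg (fun _ _ => by positivity)]
  refine Finset.prod_congr rfl fun i _ => ?_
  rw [gaussianPDF, gaussianPDFReal]
  congr 1
  simp only [NNReal.coe_one, mul_one, Pi.sub_apply]
  congr 2
  ring

lemma dotProduct_loss (M A : Mat n p) (c : Fin p → ℝ) :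
    c ⬝ᵥ (loss M A *ᵥ c) = normSqMulVec c (A - M) := by
  rw [loss, ← Matrix.mulVec_mulVec, Matrix.dotProduct_mulVec, Matrix.vecMul_transpose]
  simp [normSqMulVec, dotProduct, Matrix.mulVec, pow_two]

/-- The Gaussian weight times the prior: the posterior distributions are its exponential tilts. -/
def gaussianPrior (π : Mat n p → ℝ≥0∞) : Measure (Mat n p) :=
  volume.withDensity fun M => ENNReal.ofReal (Real.exp (-(frob M M / 2))) * π M

/-- Expanding |X - M|² splits the density into a factor in X, a factor in M absorbed by the prior,
and the tilt exp⟨X, M⟩. -/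
lemma lintegral_normalDensity_mul {π : Mat n p → ℝ≥0∞} (hπ : Measurable π)
    {G : Mat n p → ℝ≥0∞} (hG : Measurable G) (X : Mat n p) :
    ∫⁻ M, G M * (normalDensity M X * π M)
      = ENNReal.ofReal (normConst n p * Real.exp (-(frob X X / 2))) *
        ∫⁻ M, G M * ENNReal.ofReal (Real.exp (frob X M)) ∂gaussianPrior π := by
  rw [gaussianPrior, lintegral_withDensity_eq_lintegral_mul _ (by fun_prop) (by fun_prop),
    ← lintegral_const_mul _ (by fun_prop)]
  refine lintegral_congr fun M => ?_
  have e : Real.exp (-(frob (X - M) (X - M) / 2))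
      = Real.exp (-(frob X X / 2)) * (Real.exp (-(frob M M / 2)) * Real.exp (frob X M)) := by
    rw [← Real.exp_add, ← Real.exp_add]
    congr 1
    simp only [map_sub, _root_.sub_apply]
    rw [frob_comm M X]
    ring
  rw [normalDensity_eq, e, ENNReal.ofReal_mul (Real.exp_pos _).le,
    ENNReal.ofReal_mul (Real.exp_pos _).le, ENNReal.ofReal_mul normConst_pos.le]
  simp only [Pi.mul_apply]
  ring

lemma marginal_eq {π : Mat n p → ℝ≥0∞} (hπ : Measurable π) (X : Mat n p) :
    marginal π X = ENNReal.ofReal (normConst n p * Real.exp (-(frob X X / 2))) *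
      ∫⁻ M, ENNReal.ofReal (Real.exp (frob X M)) ∂gaussianPrior π := by
  have := lintegral_normalDensity_mul hπ measurable_one X
  simpa [marginal] using this

lemma expIntegrable_one_gaussianPrior {π : Mat n p → ℝ≥0∞} (hπ : Measurable π)
    (hfin : ∀ X, marginal π X < ∞) : ExpIntegrable (gaussianPrior π) fun _ => 1 := by
  refine expIntegrable_one fun X => ⟨by fun_prop, ?_⟩
  have h := hfin X
  rw [marginal_eq hπ] at h
  rw [hasFiniteIntegral_iff_ofReal (Filter.Eventually.of_forall fun M => (Real.exp_pos _).le)]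
  have hc : ENNReal.ofReal (normConst n p * Real.exp (-(frob X X / 2))) ≠ 0 := by
    simpa using mul_pos normConst_pos (Real.exp_pos _)
  exact ENNReal.lt_top_of_mul_ne_top_right h.ne hc

lemma marginal_eq_partitionFn {π : Mat n p → ℝ≥0∞} (hπ : Measurable π)
    (hfin : ∀ X, marginal π X < ∞) (X : Mat n p) :
    marginal π X = ENNReal.ofReal
      (normConst n p * Real.exp (-(frob X X / 2)) * partitionFn (gaussianPrior π) X) := by
  have h1 := expIntegrable_one_gaussianPrior hπ hfin
  rw [marginal_eq hπ, ENNReal.ofReal_mul (mul_pos normConst_pos (Real.exp_pos _)).le,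
    partitionFn_eq, ofReal_integral_eq_lintegral_ofReal (h1.integrable_exp_frob X)
    (Filter.Eventually.of_forall fun M => (Real.exp_pos _).le)]

lemma lintegral_eq_marginal_mul_posterior {π : Mat n p → ℝ≥0∞} (hπ : Measurable π)
    (hfin : ∀ X, marginal π X < ∞) [NeZero (gaussianPrior π)]
    {G : Mat n p → ℝ≥0∞} (hG : Measurable G) (X : Mat n p) :
    ∫⁻ M, G M * (normalDensity M X * π M)
      = marginal π X * ∫⁻ M, G M ∂posterior (gaussianPrior π) X := by
  rw [lintegral_normalDensity_mul hπ hG,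
    lintegral_posterior (expIntegrable_one_gaussianPrior hπ hfin) hG, marginal_eq_partitionFn hπ hfin,
    ENNReal.ofReal_mul (mul_pos normConst_pos (Real.exp_pos _)).le, mul_assoc]

/-- Lower semicontinuity makes {π > 0} open, so one point where π is nonzero already gives positive
Lebesgue measure. -/
lemma neZero_gaussianPrior {π : Mat n p → ℝ≥0∞} (hπ : LowerSemicontinuous π)
    (hπ0 : ∃ M, π M ≠ 0) : NeZero (gaussianPrior π) := by
  constructor
  obtain ⟨M, hM⟩ := hπ0
  have hm := hπ.measurable
  rw [gaussianPrior, Ne, withDensity_eq_zero_iff (by fun_prop)]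
  intro h
  have hopen : IsOpen {N | 0 < π N} := hπ.isOpen_preimage 0
  have hpos := hopen.measure_pos (volume : Measure (Mat n p)) ⟨M, pos_iff_ne_zero.2 hM⟩
  refine hpos.ne' (measure_mono_null (fun N hN => ?_) h)
  simp only [Set.mem_ofPred_eq, Set.mem_compl_iff, Pi.zero_apply] at hN ⊢
  simp [hN.ne', Real.exp_pos]

lemma marginal_pos {π : Mat n p → ℝ≥0∞} (hπ : Measurable π)
    (hfin : ∀ X, marginal π X < ∞) [NeZero (gaussianPrior π)] (X : Mat n p) :
    0 < marginal π X := by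
  rw [marginal_eq_partitionFn hπ hfin, ENNReal.ofReal_pos]
  exact mul_pos (mul_pos normConst_pos (Real.exp_pos _))
    ((expIntegrable_one_gaussianPrior hπ hfin).partitionFn_pos X)

/-- Tweedie's formula: log Z contributes the posterior mean and the Gaussian factor contributes -X.
-/
lemma hasFDerivAt_log_marginal {π : Mat n p → ℝ≥0∞} (hπ : Measurable π)
    (hfin : ∀ X, marginal π X < ∞) [NeZero (gaussianPrior π)] (X : Mat n p) :
    HasFDerivAt (fun X => Real.log (marginal π X).toReal)
      (frob (posteriorMean (gaussianPrior π) X - X)) X := by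
  have h1 := expIntegrable_one_gaussianPrior hπ hfin
  have e : ∀ Y, Real.log (marginal π Y).toReal
      = Real.log (Real.exp (-(1 * frob Y Y / 2))) + (Real.log (partitionFn (gaussianPrior π) Y)
        + Real.log (normConst n p)) := by
    intro Y
    have hZ := h1.partitionFn_pos Y
    have hc := normConst_pos (n := n) (p := p)
    rw [marginal_eq_partitionFn hπ hfin, ENNReal.toReal_ofReal
      (mul_pos (mul_pos hc (Real.exp_pos _)) hZ).le,
      Real.log_mul (mul_pos hc (Real.exp_pos _)).ne' hZ.ne',
      Real.log_mul hc.ne' (Real.exp_pos _).ne', one_mul]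
    ring
  simp_rw [e]
  have d1 := (hasFDerivAt_gaussianWeight 1 X).log (Real.exp_pos _).ne'
  have d2 : HasFDerivAt (partitionFn (gaussianPrior π))
      (fderiv ℝ (partitionFn (gaussianPrior π)) X) X :=
    (h1.differentiable_laplace frob X).hasFDerivAt
  refine (d1.add ((d2.log (h1.partitionFn_pos X).ne').add_const _)).congr_fderiv ?_
  ext v
  have hE := (Real.exp_pos (-(frob X X / 2))).ne'
  rw [frob_comm _ v, map_sub, h1.frob_posteriorMean_eq_div, frob_comm v X]
  simp [h1.fderiv_partitionFn_apply]
  field_simp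
  ring

lemma bayesEstimator_eq_posteriorMean {π : Mat n p → ℝ≥0∞} (hπ : Measurable π)
    (hfin : ∀ X, marginal π X < ∞) [NeZero (gaussianPrior π)] :
    bayesEstimator π = posteriorMean (gaussianPrior π) := by
  ext X a i
  have h := hasFDerivAt_log_marginal hπ hfin X
  simp only [bayesEstimator, Pi.add_apply, matrixGradient]
  rw [h.differentiableAt.lineDeriv_eq_fderiv, h.fderiv, frob_comm, frob_single]
  simp

lemma posteriorRisk_eq {π : Mat n p → ℝ≥0∞} (hπ : Measurable π)
    (hfin : ∀ X, marginal π X < ∞) [NeZero (gaussianPrior π)] (X A : Mat n p) (c : Fin p → ℝ) :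
    posteriorRisk π X A c = ENNReal.ofReal (posteriorVar (gaussianPrior π) c X +
      normSqMulVec c (A - posteriorMean (gaussianPrior π) X)) := by
  have h1 := expIntegrable_one_gaussianPrior hπ hfin
  simp_rw [posteriorRisk, dotProduct_loss]
  have hc : Continuous fun M : Mat n p => normSqMulVec c (A - M) := by fun_prop
  rw [lintegral_eq_marginal_mul_posterior hπ hfin hc.measurable.ennreal_ofReal,
    h1.lintegral_normSqMulVec_sub, mul_comm,
    ENNReal.mul_div_cancel_right (marginal_pos hπ hfin X).ne' (hfin X).ne]

lemma isGeneralizedBayes_iff {π : Mat n p → ℝ≥0∞} (hπ : Measurable π)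
    (hfin : ∀ X, marginal π X < ∞) [NeZero (gaussianPrior π)] (δ : Mat n p → Mat n p) :
    IsGeneralizedBayes π δ ↔ δ = posteriorMean (gaussianPrior π) := by
  have h1 := expIntegrable_one_gaussianPrior hπ hfin
  have h0 : ∀ c, normSqMulVec c (0 : Mat n p) = 0 := fun c => by simp [normSqMulVec]
  constructor
  · intro h
    ext X a i
    -- Testing with the i-th basis vector isolates column i, where equal risk forces a vanishing
    -- bias.
    have h2 := h X (posteriorMean (gaussianPrior π) X) (Pi.single i 1)
    rw [posteriorRisk_eq hπ hfin, posteriorRisk_eq hπ hfin, sub_self, h0, add_zero,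
      ENNReal.ofReal_le_ofReal_iff (h1.posteriorVar_nonneg _ _)] at h2
    have h3 : normSqMulVec (Pi.single i 1) (δ X - posteriorMean (gaussianPrior π) X) ≤ 0 := by
      linarith
    have h4 := (Finset.sum_eq_zero_iff_of_nonneg (fun _ _ => sq_nonneg _)).1
      (le_antisymm h3 (normSqMulVec_nonneg _ _)) a (Finset.mem_univ a)
    have h5 := pow_eq_zero_iff (two_ne_zero) |>.1 h4
    simp only [Pi.sub_apply, dotProduct_single, mul_one] at h5
    linarith
  · rintro rfl X A c
    rw [posteriorRisk_eq hπ hfin, posteriorRisk_eq hπ hfin, sub_self, h0]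
    exact ENNReal.ofReal_le_ofReal (add_le_add_right (normSqMulVec_nonneg _ _) _)

/-! ### Gaussian integrals -/

lemma normConst_mul_integral_gaussianWeight :
    normConst n p * ∫ X : Mat n p, Real.exp (-(1 * frob X X / 2)) = 1 := by
  simp_rw [exp_frob_eq_prod]
  rw [integral_fintype_prod_volume_eq_prod (fun (_ : Fin n) (x : Fin p → ℝ) =>
    ∏ i, Real.exp (-(1 / 2) * x i ^ 2))]
  simp_rw [integral_fintype_prod_volume_eq_prod (fun (_ : Fin p) (x : ℝ) =>
    Real.exp (-(1 / 2) * x ^ 2)), integral_gaussian]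
  rw [normConst]
  simp_rw [← Finset.prod_mul_distrib]
  refine Finset.prod_eq_one fun _ _ => Finset.prod_eq_one fun _ _ => ?_
  rw [show Real.pi / (1 / 2) = 2 * Real.pi by ring]
  exact inv_mul_cancel₀ (by positivity)

lemma lintegral_gaussianWeight {r : ℝ} (hr : 0 < r) :
    ∫⁻ X : Mat n p, ENNReal.ofReal (Real.exp (-(r * frob X X / 2)))
      = ENNReal.ofReal (∫ X : Mat n p, Real.exp (-(r * frob X X / 2))) :=
  (ofReal_integral_eq_lintegral_ofReal (integrable_gaussianWeight hr)
    (Filter.Eventually.of_forall fun _ => (Real.exp_pos _).le)).symm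

lemma integral_gaussianWeight_pos {r : ℝ} (hr : 0 < r) :
    0 < ∫ X : Mat n p, Real.exp (-(r * frob X X / 2)) :=
  integral_exp_pos (integrable_gaussianWeight hr)

lemma lintegral_normalDensity (M : Mat n p) : ∫⁻ X, normalDensity M X = 1 := by
  simp_rw [normalDensity_eq]
  rw [lintegral_const_mul _ (by fun_prop),
    lintegral_sub_right_eq_self (fun X => ENNReal.ofReal (Real.exp (-(frob X X / 2)))) M]
  have h := lintegral_gaussianWeight (n := n) (p := p) one_pos
  have h2 := normConst_mul_integral_gaussianWeight (n := n) (p := p)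
  simp only [one_mul] at h h2
  rw [h, ← ENNReal.ofReal_mul normConst_pos.le, h2, ENNReal.ofReal_one]

lemma measurable_normalDensity (M : Mat n p) : Measurable (normalDensity M) := by
  simp_rw [funext (normalDensity_eq M)]
  fun_prop

lemma risk_eq {δ : Mat n p → Mat n p} (hδ : Measurable δ) (M : Mat n p) (c : Fin p → ℝ) :
    risk δ M c = ∫⁻ X, normalDensity M X * ENNReal.ofReal (normSqMulVec c (δ X - M)) := by
  simp_rw [risk, dotProduct_loss]
  have hc : Continuous fun A : Mat n p => normSqMulVec c (A - M) := by fun_prop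
  exact lintegral_withDensity_eq_lintegral_mul _ (measurable_normalDensity M)
    (hc.measurable.comp hδ).ennreal_ofReal

lemma frob_single_self (a : Fin n) (c : Fin p → ℝ) :
    frob (Pi.single a c) (Pi.single a c) = c ⬝ᵥ c := by
  simp [frob_single]

/-- Among all centres, the second moment of a centred Gaussian weight is the smallest. -/
lemma le_integral_gaussianWeight_mul_normSqMulVec {r : ℝ} (hr : 0 < r) (c : Fin p → ℝ)
    (A : Mat n p) :
    Integrable (fun N : Mat n p => Real.exp (-(r * frob N N / 2)) * normSqMulVec c (A - N)) ∧
    n * (c ⬝ᵥ c) / r * ∫ N : Mat n p, Real.exp (-(r * frob N N / 2))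
      ≤ ∫ N : Mat n p, Real.exp (-(r * frob N N / 2)) * normSqMulVec c (A - N) := by
  have hw := expIntegrable_gaussianWeight (n := n) (p := p) hr
  set I := ∫ N : Mat n p, Real.exp (-(r * frob N N / 2)) with hI
  have hI0 : 0 < I := integral_gaussianWeight_pos hr
  have main : ∀ a : Fin n,
      Integrable (fun N : Mat n p => Real.exp (-(r * frob N N / 2)) *
        frob (Pi.single a c) (A - N) ^ 2) ∧
      (c ⬝ᵥ c) / r * I ≤ ∫ N : Mat n p, Real.exp (-(r * frob N N / 2)) *
        frob (Pi.single a c) (A - N) ^ 2 := by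
    intro a
    set v : Mat n p := Pi.single a c with hv
    set α := frob v A
    -- With x = ⟨v, N⟩ one has (α - x)² = x(x - 2α) + α²; Stein's identity evaluates the first term
    -- because x - 2α has constant derivative c·c along v.
    set g : Mat n p → ℝ := fun N => frob v N - 2 * α with hg
    have hgd : ∀ N, HasFDerivAt g (frob v) N := fun N => (frob v).hasFDerivAt.sub_const _
    have hfd : ∀ N, fderiv ℝ g N v = c ⬝ᵥ c := fun N => by
      rw [(hgd N).fderiv, hv, frob_single_self]
    have hgdiff : Differentiable ℝ g := fun N => (hgd N).differentiableAt
    have hb : ∀ N, |g N| ≤ (‖frob v‖ + 2 * |α|) * Real.exp (1 * ‖N‖) := by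
      intro N
      have h1 := abs_clm_le_exp (frob v) N
      have h2 : |g N| ≤ |frob v N| + |2 * α| := abs_sub _ _
      have h3 : 1 ≤ Real.exp (1 * ‖N‖) := Real.one_le_exp (by positivity)
      rw [abs_mul, abs_two] at h2
      nlinarith [abs_nonneg α]
    have hst := integral_gaussianWeight_mul_frob hr hgdiff v hb
      (by simp_rw [hfd]; fun_prop) (C' := |c ⬝ᵥ c|) (k' := 0) (fun N => by rw [hfd]; simp)
    simp_rw [hfd] at hst
    rw [integral_mul_const, ← hI] at hst
    have e : ∀ N : Mat n p, Real.exp (-(r * frob N N / 2)) * frob v (A - N) ^ 2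
        = Real.exp (-(r * frob N N / 2)) * (frob v N * g N)
          + Real.exp (-(r * frob N N / 2)) * α ^ 2 := by
      intro N
      simp only [hg, map_sub]
      ring
    have i1 : Integrable fun N : Mat n p => Real.exp (-(r * frob N N / 2)) * (frob v N * g N) := by
      simp_rw [← mul_assoc]
      exact ((hw.mul_clm (frob v)).mul_of_le hgdiff.continuous.aestronglyMeasurable hb).integrable
    have i2 : Integrable fun N : Mat n p => Real.exp (-(r * frob N N / 2)) * α ^ 2 :=
      (integrable_gaussianWeight hr).mul_const _
    simp_rw [e]
    refine ⟨i1.add i2, ?_⟩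
    rw [integral_add i1 i2, integral_mul_const, ← hI]
    have h5 : ∫ N : Mat n p, Real.exp (-(r * frob N N / 2)) * (frob v N * g N)
        = (c ⬝ᵥ c) / r * I := by
      rw [div_mul_eq_mul_div, eq_div_iff hr.ne']
      linarith
    rw [h5]
    nlinarith [sq_nonneg α]
  simp_rw [normSqMulVec_eq_sum_frob, Finset.mul_sum]
  refine ⟨integrable_finsetSum _ fun a _ => (main a).1, ?_⟩
  rw [integral_finsetSum _ fun a _ => (main a).1]
  calc n * (c ⬝ᵥ c) / r * I = ∑ _a : Fin n, (c ⬝ᵥ c) / r * I := by simp; ring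
    _ ≤ _ := Finset.sum_le_sum fun a _ => (main a).2

lemma le_lintegral_gaussianWeight_mul_normSqMulVec {r : ℝ} (hr : 0 < r) (c : Fin p → ℝ)
    (A : Mat n p) :
    ENNReal.ofReal (n * (c ⬝ᵥ c) / r) *
        ∫⁻ N : Mat n p, ENNReal.ofReal (Real.exp (-(r * frob N N / 2)))
      ≤ ∫⁻ N : Mat n p, ENNReal.ofReal (Real.exp (-(r * frob N N / 2))) *
          ENNReal.ofReal (normSqMulVec c (A - N)) := by
  obtain ⟨h1, h2⟩ := le_integral_gaussianWeight_mul_normSqMulVec hr c A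
  have hc : 0 ≤ c ⬝ᵥ c := Finset.sum_nonneg fun i _ => mul_self_nonneg _
  rw [lintegral_gaussianWeight hr, ← ENNReal.ofReal_mul (by positivity)]
  simp_rw [← ENNReal.ofReal_mul (Real.exp_pos _).le]
  rw [← ofReal_integral_eq_lintegral_ofReal h1 (Filter.Eventually.of_forall fun N =>
    mul_nonneg (Real.exp_pos _).le (normSqMulVec_nonneg _ _))]
  exact ENNReal.ofReal_le_ofReal h2

/-! ### The minimax lower bound -/

/-- Completing the square: under a normal prior of precision ε the posterior is normal with
precision 1 + ε and centre X/(1 + ε). -/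
lemma normalDensity_mul_gaussianWeight {ε : ℝ} (hε : 0 < ε) (X M : Mat n p) :
    normalDensity M X * ENNReal.ofReal (Real.exp (-(ε * frob M M / 2)))
      = ENNReal.ofReal (normConst n p * Real.exp (-(ε * (1 + ε)⁻¹ * frob X X / 2))) *
        ENNReal.ofReal (Real.exp (-((1 + ε) *
          frob (M - (1 + ε)⁻¹ • X) (M - (1 + ε)⁻¹ • X) / 2))) := by
  rw [normalDensity_eq, ← ENNReal.ofReal_mul normConst_pos.le,
    ← ENNReal.ofReal_mul (by have := normConst_pos (n := n) (p := p); positivity),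
    ← ENNReal.ofReal_mul (by have := normConst_pos (n := n) (p := p); positivity),
    mul_assoc, mul_assoc, ← Real.exp_add, ← Real.exp_add]
  congr 3
  have hne : (1 + ε) ≠ 0 := by positivity
  simp only [map_sub, map_smul, _root_.sub_apply, _root_.smul_apply, smul_eq_mul]
  rw [frob_comm M X]
  field_simp
  ring

lemma le_lintegral_mul_normalDensity {ε : ℝ} (hε : 0 < ε) (c : Fin p → ℝ) (X A : Mat n p) :
    ENNReal.ofReal (n * (c ⬝ᵥ c) / (1 + ε)) *
        ∫⁻ M, normalDensity M X * ENNReal.ofReal (Real.exp (-(ε * frob M M / 2)))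
      ≤ ∫⁻ M, normalDensity M X * ENNReal.ofReal (Real.exp (-(ε * frob M M / 2))) *
          ENNReal.ofReal (normSqMulVec c (A - M)) := by
  have hr : 0 < 1 + ε := by positivity
  simp_rw [normalDensity_mul_gaussianWeight hε, mul_assoc]
  have hc : Continuous fun M : Mat n p => normSqMulVec c (A - M) := by fun_prop
  rw [lintegral_const_mul _ (by fun_prop), lintegral_const_mul _ (by fun_prop), mul_left_comm]
  gcongr
  have h := le_lintegral_gaussianWeight_mul_normSqMulVec hr c (A - (1 + ε)⁻¹ • X)
  rw [lintegral_sub_right_eq_self (fun M => ENNReal.ofReal (Real.exp (-((1 + ε) *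
    frob M M / 2)))) ((1 + ε)⁻¹ • X)]
  rw [← lintegral_sub_right_eq_self (fun N => ENNReal.ofReal (Real.exp (-((1 + ε) *
    frob N N / 2))) * ENNReal.ofReal (normSqMulVec c (A - (1 + ε)⁻¹ • X - N)))
    ((1 + ε)⁻¹ • X)] at h
  simpa only [sub_sub_sub_cancel_right] using h

/-- The Bayes risk under a finite prior `W` is a lower bound for the worst case risk. -/
lemma le_iSup_of_bayes {α β : Type*} [MeasurableSpace α] [MeasurableSpace β] {μ : Measure α}
    {ν : Measure β} [SFinite μ] [SFinite ν] {k L : α → β → ℝ≥0∞} {W : α → ℝ≥0∞} {b : ℝ≥0∞}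
    (hk : Measurable fun q : α × β => k q.1 q.2) (hL : Measurable fun q : α × β => L q.1 q.2)
    (hW : Measurable W) (hk1 : ∀ θ, ∫⁻ x, k θ x ∂ν = 1) (hW0 : ∫⁻ θ, W θ ∂μ ≠ 0)
    (hW1 : ∫⁻ θ, W θ ∂μ ≠ ∞)
    (hb : ∀ x, b * ∫⁻ θ, k θ x * W θ ∂μ ≤ ∫⁻ θ, k θ x * W θ * L θ x ∂μ) :
    b ≤ ⨆ θ, ∫⁻ x, k θ x * L θ x ∂ν := by
  have hkW : Measurable fun q : α × β => k q.1 q.2 * W q.1 := hk.mul (hW.comp measurable_fst)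
  have hkθ : ∀ θ, Measurable (k θ) := fun θ => hk.comp measurable_prodMk_left
  have hLθ : ∀ θ, Measurable (L θ) := fun θ => hL.comp measurable_prodMk_left
  refine (ENNReal.mul_le_mul_iff_left hW0 hW1).1 ?_
  calc b * ∫⁻ θ, W θ ∂μ
      = b * ∫⁻ θ, ∫⁻ x, k θ x * W θ ∂ν ∂μ := by
        congr 1
        refine lintegral_congr fun θ => ?_
        rw [lintegral_mul_const _ (hkθ θ), hk1, one_mul]
    _ = b * ∫⁻ x, ∫⁻ θ, k θ x * W θ ∂μ ∂ν := by
        rw [lintegral_lintegral_swap hkW.aemeasurable]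
    _ = ∫⁻ x, b * ∫⁻ θ, k θ x * W θ ∂μ ∂ν := by
        rw [lintegral_const_mul]
        exact (hkW.comp measurable_swap).lintegral_prod_right'
    _ ≤ ∫⁻ x, ∫⁻ θ, k θ x * W θ * L θ x ∂μ ∂ν := lintegral_mono hb
    _ = ∫⁻ θ, ∫⁻ x, k θ x * W θ * L θ x ∂ν ∂μ :=
        (lintegral_lintegral_swap (hkW.mul hL).aemeasurable).symm
    _ = ∫⁻ θ, (∫⁻ x, k θ x * L θ x ∂ν) * W θ ∂μ := by
        refine lintegral_congr fun θ => ?_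
        have h : Measurable fun x => k θ x * L θ x := (hkθ θ).mul (hLθ θ)
        rw [← lintegral_mul_const _ h]
        exact lintegral_congr fun x => by ring
    _ ≤ ∫⁻ θ, (⨆ θ, ∫⁻ x, k θ x * L θ x ∂ν) * W θ ∂μ := by
        refine lintegral_mono fun θ => ?_
        simp only
        gcongr
        exact le_iSup (fun θ => ∫⁻ x, k θ x * L θ x ∂ν) θ
    _ = _ := lintegral_const_mul _ hW

/-- For a normal prior of precision ε every estimate has posterior risk at least n|c|²/(1 + ε),
whatever X is; the bound survives integration over X, and then ε → 0. -/
lemma le_iSup_risk {δ : Mat n p → Mat n p} (hδ : Measurable δ) (c : Fin p → ℝ) :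
    ENNReal.ofReal (n * (c ⬝ᵥ c)) ≤ ⨆ M, risk δ M c := by
  have hk : Measurable fun q : Mat n p × Mat n p => normalDensity q.1 q.2 := by
    simp_rw [normalDensity_eq]
    fun_prop
  have hL : Measurable fun q : Mat n p × Mat n p =>
      ENNReal.ofReal (normSqMulVec c (δ q.2 - q.1)) :=
    ((continuous_normSqMulVec c).measurable.comp
      ((hδ.comp measurable_snd).sub measurable_fst)).ennreal_ofReal
  simp_rw [risk_eq hδ]
  have key : ∀ ε : ℝ, 0 < ε → ENNReal.ofReal (n * (c ⬝ᵥ c) / (1 + ε)) ≤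
      ⨆ M, ∫⁻ X, normalDensity M X * ENNReal.ofReal (normSqMulVec c (δ X - M)) := by
    intro ε hε
    refine le_iSup_of_bayes (μ := volume)
      (W := fun M => ENNReal.ofReal (Real.exp (-(ε * frob M M / 2)))) hk hL (by fun_prop)
      lintegral_normalDensity ?_ ?_ fun X => le_lintegral_mul_normalDensity hε c X (δ X)
    · rw [lintegral_gaussianWeight hε]
      simpa using integral_gaussianWeight_pos hε
    · rw [lintegral_gaussianWeight hε]
      exact ENNReal.ofReal_ne_top
  have hlim : Filter.Tendsto (fun ε : ℝ => ENNReal.ofReal (n * (c ⬝ᵥ c) / (1 + ε)))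
      (nhdsWithin 0 (Set.Ioi 0)) (nhds (ENNReal.ofReal (n * (c ⬝ᵥ c)))) := by
    have hc : ContinuousAt (fun ε : ℝ => n * (c ⬝ᵥ c) / (1 + ε)) 0 :=
      ContinuousAt.div continuousAt_const (by fun_prop) (by norm_num)
    have := (ENNReal.continuous_ofReal.continuousAt.comp hc).tendsto.mono_left
      (nhdsWithin_le_nhds (s := Set.Ioi 0))
    simpa [Function.comp_def] using this
  exact le_of_tendsto hlim (Filter.eventually_of_mem self_mem_nhdsWithin key)

/-! ### The risk of the generalized Bayes estimator -/

lemma lintegral_normalDensity_mul_translate {π : Mat n p → ℝ≥0∞} (hπ : Measurable π)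
    {G : Mat n p → ℝ≥0∞} (hG : Measurable G) (X : Mat n p) :
    ∫⁻ M, G M * (normalDensity M X * π M) = ENNReal.ofReal (normConst n p) *
      ∫⁻ N, G (X + N) * (ENNReal.ofReal (Real.exp (-(frob N N / 2))) * π (X + N)) := by
  rw [← lintegral_const_mul _ (by fun_prop), ← lintegral_add_left_eq_self _ X]
  refine lintegral_congr fun N => ?_
  rw [normalDensity_eq]
  simp only [sub_add_cancel_left, map_neg, _root_.neg_apply, neg_neg]
  ring

lemma marginal_eq_translate {π : Mat n p → ℝ≥0∞} (hπ : Measurable π) (X : Mat n p) :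
    marginal π X = ENNReal.ofReal (normConst n p) *
      ∫⁻ N, ENNReal.ofReal (Real.exp (-(frob N N / 2))) * π (X + N) := by
  have := lintegral_normalDensity_mul_translate hπ measurable_one X
  simpa [marginal] using this

/-- Under a matrix superharmonic prior, the posterior second moments about the observation are at
most the prior ones. -/
lemma IsMatrixSuperharmonic.posteriorVar_add_le {π : Mat n p → ℝ≥0∞}
    (hπ : IsMatrixSuperharmonic π) (hn : 0 < n) (hfin : ∀ X, marginal π X < ∞)
    [NeZero (gaussianPrior π)] (c : Fin p → ℝ) (X : Mat n p) :
    posteriorVar (gaussianPrior π) c X +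
      normSqMulVec c (X - posteriorMean (gaussianPrior π) X) ≤ n * (c ⬝ᵥ c) := by
  have hm := hπ.lowerSemicontinuous.measurable
  have h1 := expIntegrable_one_gaussianPrior hm hfin
  have hcc : 0 ≤ c ⬝ᵥ c := Finset.sum_nonneg fun i _ => mul_self_nonneg _
  have hκ : ENNReal.ofReal (normConst n p) ≠ 0 := by simpa using normConst_pos
  have hfin' : ∫⁻ N, ENNReal.ofReal (Real.exp (-(frob N N / 2))) * π (X + N) ≠ ∞ := by
    have h := hfin X
    rw [marginal_eq_translate hm] at h
    exact (ENNReal.lt_top_of_mul_ne_top_right h.ne hκ).ne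
  have hle := hπ.lintegral_normSqMulVec_le hn X hfin' c
  have hc : Continuous fun M : Mat n p => normSqMulVec c (X - M) := by fun_prop
  have e1 := lintegral_normalDensity_mul_translate hm hc.measurable.ennreal_ofReal X
  have e2 : ∀ N : Mat n p, normSqMulVec c (X - (X + N)) = normSqMulVec c N := by
    intro N
    simp [normSqMulVec]
  simp_rw [e2] at e1
  rw [lintegral_eq_marginal_mul_posterior hm hfin hc.measurable.ennreal_ofReal,
    h1.lintegral_normSqMulVec_sub] at e1
  have h2 : marginal π X * ENNReal.ofReal (posteriorVar (gaussianPrior π) c X +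
      normSqMulVec c (X - posteriorMean (gaussianPrior π) X))
      ≤ marginal π X * ENNReal.ofReal (n * (c ⬝ᵥ c)) := by
    rw [e1, marginal_eq_translate hm X, mul_assoc]
    gcongr
    rw [mul_comm]
    exact hle
  rw [ENNReal.mul_le_mul_iff_right (marginal_pos hm hfin X).ne' (hfin X).ne,
    ENNReal.ofReal_le_ofReal_iff (by positivity)] at h2
  exact h2

lemma ExpIntegrable.variance_frob_nonneg {ν : Measure (Mat n p)} [NeZero ν]
    (h1 : ExpIntegrable ν fun _ => 1) (v X : Mat n p) :
    0 ≤ ∫ M, frob v M * frob v M ∂posterior ν X - frob v (posteriorMean ν X) ^ 2 := by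
  have h := h1.integral_frob_sub_sq v X (posteriorMean ν X)
  rw [sub_self, map_zero, zero_pow two_ne_zero, add_zero] at h
  rw [← h]
  exact integral_nonneg fun M => sq_nonneg _

/-- If the posterior second moments about the observation are bounded by the prior ones, then so is
the risk of the posterior mean. -/
lemma integral_gaussianWeight_mul_posteriorMean_le {ν : Measure (Mat n p)} [NeZero ν]
    (h1 : ExpIntegrable ν fun _ => 1) (c : Fin p → ℝ)
    (hν : ∀ X, posteriorVar ν c X + normSqMulVec c (X - posteriorMean ν X) ≤ n * (c ⬝ᵥ c))
    (M : Mat n p) :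
    Integrable (fun Y : Mat n p => Real.exp (-(1 * frob Y Y / 2)) *
      normSqMulVec c (posteriorMean ν (M + Y) - M)) ∧
    ∫ Y : Mat n p, Real.exp (-(1 * frob Y Y / 2)) * normSqMulVec c (posteriorMean ν (M + Y) - M)
      ≤ n * (c ⬝ᵥ c) * ∫ Y : Mat n p, Real.exp (-(1 * frob Y Y / 2)) := by
  have hw := expIntegrable_gaussianWeight (n := n) (p := p) one_pos
  have hcc : 0 ≤ c ⬝ᵥ c := Finset.sum_nonneg fun i _ => mul_self_nonneg _
  set S : ℝ := n * (c ⬝ᵥ c) with hS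
  have hS0 : 0 ≤ S := by positivity
  set w : Mat n p → ℝ := fun Y => Real.exp (-(1 * frob Y Y / 2)) with hwdef
  set T := posteriorMean ν with hT
  -- directional variances and deviations
  set V : Fin n → Mat n p → ℝ := fun a X =>
    ∫ M, frob (Pi.single a c) M * frob (Pi.single a c) M ∂posterior ν X
      - frob (Pi.single a c) (T X) ^ 2 with hV
  have hV0 : ∀ a X, 0 ≤ V a X := fun a X => h1.variance_frob_nonneg _ X
  -- The hypothesis bounds both the variances and the deviations by S uniformly; this supplies all
  -- the growth conditions for Stein's identity.
  have hVle : ∀ a X, V a X ≤ S := by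
    intro a X
    have e1 : V a X ≤ posteriorVar ν c X :=
      Finset.single_le_sum (f := fun a => V a X) (fun a _ => hV0 a X) (Finset.mem_univ a)
    linarith [hν X, normSqMulVec_nonneg c (X - T X)]
  set g : Fin n → Mat n p → ℝ := fun a Y => frob (Pi.single a c) (T (M + Y) - (M + Y)) with hg
  have hg2 : ∀ a Y, g a Y ^ 2 ≤ S := by
    intro a Y
    have e1 : frob (Pi.single a c) (M + Y - T (M + Y)) ^ 2 ≤ normSqMulVec c (M + Y - T (M + Y)) := by
      rw [normSqMulVec_eq_sum_frob]
      exact Finset.single_le_sum (f := fun a => frob (Pi.single a c) (M + Y - T (M + Y)) ^ 2)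
        (fun a _ => sq_nonneg _) (Finset.mem_univ a)
    have e2 : g a Y ^ 2 = frob (Pi.single a c) (M + Y - T (M + Y)) ^ 2 := by
      simp only [hg]
      rw [← neg_sub, map_neg, neg_sq]
    linarith [hν (M + Y), h1.posteriorVar_nonneg c (M + Y)]
  have hgabs : ∀ a Y, |g a Y| ≤ Real.sqrt S := fun a Y => Real.abs_le_sqrt (hg2 a Y)
  -- With x = ⟨e_a cᵀ, Y⟩ the loss term is (x + g)² = x(x + 2g) + g², so a single use of Stein's
  -- identity on h = x + 2g suffices; its derivative along e_a cᵀ is 2V - c·c.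
  set h : Fin n → Mat n p → ℝ := fun a Y => frob (Pi.single a c) Y + 2 * g a Y with hh
  have hTd : ∀ a Y, HasFDerivAt (fun Y => frob (Pi.single a c) (T (M + Y)))
      (fderiv ℝ (fun X => frob (Pi.single a c) (T X)) (M + Y)) Y := fun a Y =>
    (hasFDerivAt_comp_add_left M).2
      (h1.differentiable_frob_posteriorMean (Pi.single a c) (M + Y)).hasFDerivAt
  have hgd : ∀ a Y, HasFDerivAt (g a)
      (fderiv ℝ (fun X => frob (Pi.single a c) (T X)) (M + Y) - frob (Pi.single a c)) Y := by
    intro a Y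
    have e := ((frob (Pi.single a c)).hasFDerivAt (x := Y)).const_add (frob (Pi.single a c) M)
    refine ((hTd a Y).sub e).congr_of_eventuallyEq (Filter.Eventually.of_forall fun Z => ?_)
    simp only [hg, map_sub, map_add]
    rfl
  have hhd : ∀ a Y, HasFDerivAt (h a) (frob (Pi.single a c) + (2 : ℝ) •
      (fderiv ℝ (fun X => frob (Pi.single a c) (T X)) (M + Y) - frob (Pi.single a c))) Y :=
    fun a Y => ((frob (Pi.single a c)).hasFDerivAt (x := Y)).add ((hgd a Y).const_mul 2)
  have hfd : ∀ a Y, fderiv ℝ (h a) Y (Pi.single a c) = 2 * V a (M + Y) - c ⬝ᵥ c := by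
    intro a Y
    have e := h1.fderiv_frob_posteriorMean (Pi.single a c) (M + Y)
    rw [(hhd a Y).fderiv]
    simp only [_root_.add_apply, _root_.smul_apply, _root_.sub_apply, smul_eq_mul,
      frob_single_self]
    rw [e]
    simp only [hV]
    ring
  have hgc : ∀ a, Continuous (g a) := fun a =>
    continuous_iff_continuousAt.2 fun Y => (hgd a Y).continuousAt
  have hhdiff : ∀ a, Differentiable ℝ (h a) := fun a Y => (hhd a Y).differentiableAt
  have hhb : ∀ a Y, |h a Y| ≤ (‖frob (Pi.single a c : Mat n p)‖ + 2 * Real.sqrt S) *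
      Real.exp (1 * ‖Y‖) := by
    intro a Y
    have e1 := abs_clm_le_exp (frob (Pi.single a c : Mat n p)) Y
    have e2 : |h a Y| ≤ |frob (Pi.single a c) Y| + |2 * g a Y| := abs_add_le _ _
    have e3 : 1 ≤ Real.exp (1 * ‖Y‖) := Real.one_le_exp (by positivity)
    rw [abs_mul, abs_two] at e2
    nlinarith [Real.sqrt_nonneg S, hgabs a Y]
  have hdm : ∀ a, AEStronglyMeasurable (fun Y => fderiv ℝ (h a) Y (Pi.single a c)) volume :=
    fun a => (measurable_fderiv_apply_const ℝ (h a) _).aestronglyMeasurable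
  have hdb : ∀ a Y, |fderiv ℝ (h a) Y (Pi.single a c)|
      ≤ (2 * S + c ⬝ᵥ c) * Real.exp (0 * ‖Y‖) := by
    intro a Y
    rw [hfd, zero_mul, Real.exp_zero, mul_one, abs_le]
    constructor <;> linarith [hV0 a (M + Y), hVle a (M + Y)]
  have hstein := fun a => integral_gaussianWeight_mul_frob one_pos (hhdiff a) (Pi.single a c)
    (hhb a) (hdm a) (hdb a)
  simp only [one_mul] at hstein
  have iD : ∀ a, Integrable fun Y : Mat n p => w Y * fderiv ℝ (h a) Y (Pi.single a c) := fun a =>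
    (hw.mul_of_le (hdm a) (hdb a)).integrable
  have iH : ∀ a, Integrable fun Y : Mat n p => w Y * (frob (Pi.single a c) Y * h a Y) := by
    intro a
    simp_rw [← mul_assoc]
    exact ((hw.mul_clm (frob (Pi.single a c))).mul_of_le
      (hhdiff a).continuous.aestronglyMeasurable (hhb a)).integrable
  have iG : ∀ a, Integrable fun Y : Mat n p => w Y * g a Y ^ 2 := fun a =>
    (hw.mul_of_le (C := S) (k := 0) ((hgc a).pow 2).aestronglyMeasurable fun Y => by
      simpa using hg2 a Y).integrable
  have e : ∀ Y : Mat n p, w Y * normSqMulVec c (T (M + Y) - M)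
      = ∑ a, (w Y * (frob (Pi.single a c) Y * h a Y) + w Y * g a Y ^ 2) := by
    intro Y
    rw [normSqMulVec_eq_sum_frob, Finset.mul_sum]
    refine Finset.sum_congr rfl fun a _ => ?_
    simp only [hh, hg, map_sub, map_add]
    ring
  change Integrable (fun Y => w Y * normSqMulVec c (T (M + Y) - M)) ∧
    ∫ Y, w Y * normSqMulVec c (T (M + Y) - M) ≤ S * ∫ Y, w Y
  simp_rw [e]
  have iS : ∀ a, Integrable fun Y : Mat n p =>
      w Y * (frob (Pi.single a c) Y * h a Y) + w Y * g a Y ^ 2 := fun a => (iH a).add (iG a)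
  refine ⟨integrable_finsetSum _ fun a _ => iS a, ?_⟩
  rw [integral_finsetSum _ fun a _ => iS a]
  calc ∑ a, ∫ Y, (w Y * (frob (Pi.single a c) Y * h a Y) + w Y * g a Y ^ 2)
      = ∑ a, ∫ Y, (w Y * fderiv ℝ (h a) Y (Pi.single a c) + w Y * g a Y ^ 2) := by
        refine Finset.sum_congr rfl fun a _ => ?_
        rw [integral_add (iH a) (iG a), integral_add (iD a) (iG a)]
        congr 1
        simpa [hwdef] using hstein a
    _ = ∫ Y, ∑ a, (w Y * fderiv ℝ (h a) Y (Pi.single a c) + w Y * g a Y ^ 2) :=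
        (integral_finsetSum _ fun a _ => (iD a).add (iG a)).symm
    _ ≤ ∫ Y, S * w Y := by
        refine integral_mono (integrable_finsetSum _ fun a _ => (iD a).add (iG a))
          (hw.integrable.const_mul S) fun Y => ?_
        have e1 : ∑ a, (w Y * fderiv ℝ (h a) Y (Pi.single a c) + w Y * g a Y ^ 2)
            = w Y * (2 * posteriorVar ν c (M + Y) - S + normSqMulVec c (M + Y - T (M + Y))) := by
          have e2 : ∑ a, g a Y ^ 2 = normSqMulVec c (M + Y - T (M + Y)) := by
            rw [normSqMulVec_eq_sum_frob]
            refine Finset.sum_congr rfl fun a _ => ?_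
            simp only [hg]
            rw [← neg_sub, map_neg, neg_sq]
          have e3 : ∑ a, V a (M + Y) = posteriorVar ν c (M + Y) := rfl
          simp_rw [hfd, ← mul_add, ← Finset.mul_sum]
          rw [Finset.sum_add_distrib, Finset.sum_sub_distrib, ← Finset.mul_sum, e2, e3]
          simp [hS]
        simp only
        rw [e1, mul_comm S]
        refine mul_le_mul_of_nonneg_left ?_ (Real.exp_pos _).le
        -- With D the squared deviation, 2V - S + D ≤ 2(V + D) - S ≤ S.
        linarith [hν (M + Y), normSqMulVec_nonneg c (M + Y - T (M + Y))]
    _ = S * ∫ Y, w Y := integral_const_mul _ _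

lemma IsMatrixSuperharmonic.risk_posteriorMean_le {π : Mat n p → ℝ≥0∞}
    (hπ : IsMatrixSuperharmonic π) (hn : 0 < n) (hfin : ∀ X, marginal π X < ∞)
    [NeZero (gaussianPrior π)] (M : Mat n p) (c : Fin p → ℝ) :
    risk (posteriorMean (gaussianPrior π)) M c ≤ ENNReal.ofReal (n * (c ⬝ᵥ c)) := by
  have hm := hπ.lowerSemicontinuous.measurable
  have h1 := expIntegrable_one_gaussianPrior hm hfin
  have hT := h1.continuous_posteriorMean
  obtain ⟨hi, hle⟩ := integral_gaussianWeight_mul_posteriorMean_le h1 c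
    (hπ.posteriorVar_add_le hn hfin c) M
  have hκ := normConst_pos (n := n) (p := p)
  rw [risk_eq hT.measurable, ← lintegral_add_left_eq_self _ M]
  have e : ∀ Y, normalDensity M (M + Y) *
      ENNReal.ofReal (normSqMulVec c (posteriorMean (gaussianPrior π) (M + Y) - M))
      = ENNReal.ofReal (normConst n p * (Real.exp (-(1 * frob Y Y / 2)) *
        normSqMulVec c (posteriorMean (gaussianPrior π) (M + Y) - M))) := by
    intro Y
    rw [normalDensity_eq, add_sub_cancel_left, one_mul, ENNReal.ofReal_mul hκ.le,
      ENNReal.ofReal_mul (Real.exp_pos _).le, mul_assoc]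
  simp_rw [e]
  rw [← ofReal_integral_eq_lintegral_ofReal (hi.const_mul _) (Filter.Eventually.of_forall fun Y =>
    mul_nonneg hκ.le (mul_nonneg (Real.exp_pos _).le (normSqMulVec_nonneg _ _))),
    integral_const_mul]
  refine ENNReal.ofReal_le_ofReal ?_
  calc _ ≤ normConst n p * (n * (c ⬝ᵥ c) * ∫ Y : Mat n p, Real.exp (-(1 * frob Y Y / 2))) := by
        gcongr
    _ = n * (c ⬝ᵥ c) * (normConst n p * ∫ Y : Mat n p, Real.exp (-(1 * frob Y Y / 2))) := by ring
    _ = n * (c ⬝ᵥ c) := by rw [normConst_mul_integral_gaussianWeight, mul_one]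

end

end MatrixBayes

/-! ### The main theorem. -/

theorem mainTheorem2 (n p : ℕ) (hn : 0 < n) (hp : 0 < p)
    (π : MatrixBayes.Mat n p → ℝ≥0∞)
    (hπ0 : ∃ M, π M ≠ 0)
    (hπ : MatrixBayes.IsMatrixSuperharmonic π)
    (hfin : ∀ X, MatrixBayes.marginal π X < ∞) :
    (∀ X, 0 < MatrixBayes.marginal π X) ∧
    Differentiable ℝ (fun X => Real.log (MatrixBayes.marginal π X).toReal) ∧
    (∀ δ : MatrixBayes.Mat n p → MatrixBayes.Mat n p,
      MatrixBayes.IsGeneralizedBayes π δ ↔ δ = MatrixBayes.bayesEstimator π) ∧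
    MatrixBayes.IsMinimax (MatrixBayes.bayesEstimator π) := by
  have hm := hπ.lowerSemicontinuous.measurable
  have := MatrixBayes.neZero_gaussianPrior hπ.lowerSemicontinuous hπ0
  have h1 := MatrixBayes.expIntegrable_one_gaussianPrior hm hfin
  have hmeas := h1.continuous_posteriorMean.measurable
  refine ⟨MatrixBayes.marginal_pos hm hfin,
    fun X => (MatrixBayes.hasFDerivAt_log_marginal hm hfin X).differentiableAt, ?_⟩
  rw [MatrixBayes.bayesEstimator_eq_posteriorMean hm hfin]
  refine ⟨MatrixBayes.isGeneralizedBayes_iff hm hfin, hmeas, fun c => le_antisymm ?_ ?_⟩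
  -- The value n|c|² separates the two sides: it bounds the risk of the posterior mean from above
  -- and every worst-case risk from below.
  · exact (iSup_le fun M => hπ.risk_posteriorMean_le hn hfin M c).trans
      (le_iInf fun δ' => MatrixBayes.le_iSup_risk δ'.2 c)
  · exact iInf_le (fun δ' : {δ' : MatrixBayes.Mat n p → MatrixBayes.Mat n p // Measurable δ'} =>
      ⨆ M, MatrixBayes.risk δ'.1 M c) ⟨_, hmeas⟩
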